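/- Let $a>0$ and $\Omega=(-a,a)^2\subset\mathbb R^2$. Let $B:\mathbb R^2\to\mathbb R$ be a locally integrable magnetic field with $\operatorname{supp}B\subset\Omega$ that is not identically zero (i.e. not zero almost everywhere). Then there is a constant $\alpha_0=\alpha_0(\Omega,B)>0$ with the following property. Let $A=(A_1,A_2):\mathbb R^2\to\mathbb R^2$ be any vector potential of $B$, i.e. $\partial_xA_2-\partial_yA_1=B$ in the sense of distributions, for which $A\psi\in L^2(\mathbb R^2)$ for all $\psi\in H^1(\mathbb R^2)$ (every bounded $A$ is such). Let $\gamma:\mathbb R\to\mathbb R$ be continuous and piecewise $C^1$, with $\gamma(x)=x$ for $|x|\ge a$ and $|\gamma(x)|\le a$ for $|x|<a$, let $\Gamma=\{(x,\gamma(x)):x\in\mathbb R\}$ and let $\mu$ be the arc length measure on $\Gamma$. For $\alpha>0$ let $H=(i\nabla+A)^2-\alpha\delta_\Gamma$ be the operator in $L^2(\mathbb R^2)$ associated with the quadratic form $$q[\psi]=\int_{\mathbb R^2}|i\nabla\psi+A\psi|^2\,dx\,dy-\alpha\int_\Gamma|\psi|^2\,d\mu,\qquad \psi\in H^1(\mathbb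 R^2),$$ where $\psi$ on $\Gamma$ is understood as the trace. If $\alpha\in(0,\alpha_0]$ and $$\|\gamma'\|_\infty^2\le\frac{2\alpha_0^2}{\alpha^2}-1,$$ then the spectrum of $H$ below $-\frac14\alpha^2$ is empty, i.e. no real $\lambda<-\frac14\alpha^2$ belongs to $\sigma(H)$. -/

import Mathlib

open MeasureTheory Filter Topology Set
open scoped ENNReal ContDiff

noncomputable section

namespace LeakyWire

/-- The Hilbert space `L²(ℝ²; ℂ)`. The plane is `ℝ × ℝ` with its Lebesgue measure; the norm of
`ℝ × ℝ` plays no role below. -/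
abbrev L2 : Type := Lp ℂ 2 (volume : Measure (ℝ × ℝ))

/-- The square `(-a, a)²`. -/
def square (a : ℝ) : Set (ℝ × ℝ) := Ioo (-a) a ×ˢ Ioo (-a) a

/-- The coordinate direction of `x`. -/
def ex : ℝ × ℝ := (1, 0)

/-- The coordinate direction of `y`. -/
def ey : ℝ × ℝ := (0, 1)

/-! ### The Sobolev space `H¹(ℝ²)` -/

/-- `g` is the weak (distributional) derivative of `ψ` in the direction `v`. -/
def IsWeakDeriv (v : ℝ × ℝ) (ψ g : L2) : Prop :=
  ∀ φ : ℝ × ℝ → ℝ, ContDiff ℝ ∞ φ → HasCompactSupport φ →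
    ∫ p, (fderiv ℝ φ p v) • ψ p = - ∫ p, φ p • g p

/-- The Sobolev space `H¹(ℝ²)`, as a set of elements of `L²(ℝ²)`. -/
def H1 : Set L2 := {ψ | (∃ g, IsWeakDeriv ex ψ g) ∧ ∃ g, IsWeakDeriv ey ψ g}

open Classical in
/-- The weak derivative in `L²` in the direction `v` (it is unique where it exists). -/
def weakDeriv (v : ℝ × ℝ) (ψ : L2) : L2 :=
  if h : ∃ g, IsWeakDeriv v ψ g then h.choose else 0

/-! ### The magnetic field and its vector potentials -/

/-- `A = (A₁, A₂)` is a vector potential for the field `B`: `∂ₓA₂ - ∂_yA₁ = B` in the sense of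
distributions, and `Aψ ∈ L²` for all `ψ ∈ H¹(ℝ²)`, that is, the magnetic form
`∫ |i∇ψ + Aψ|²` is defined on all of `H¹(ℝ²)`. The second requirement holds for every bounded
measurable `A`; it implies that `A` is measurable and locally square integrable. -/
structure IsVectorPotential (B : ℝ × ℝ → ℝ) (A : ℝ × ℝ → ℝ × ℝ) : Prop where
  memLp_fst : ∀ ψ ∈ H1, MemLp (fun p => ((A p).1 : ℂ) * ψ p) 2 volume
  memLp_snd : ∀ ψ ∈ H1, MemLp (fun p => ((A p).2 : ℂ) * ψ p) 2 volume
  rot_eq : ∀ φ : ℝ × ℝ → ℝ, ContDiff ℝ ∞ φ → HasCompactSupport φ →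
    ∫ p, ((A p).1 * fderiv ℝ φ p ey - (A p).2 * fderiv ℝ φ p ex) = ∫ p, B p * φ p

/-! ### The curve `Γ = {(x, γ(x))}` -/

/-- `γ` is continuous and piecewise `C¹`: it is `C¹` off a finite set, at whose points the
derivative has finite one-sided limits. -/
def IsPiecewiseC1 (γ : ℝ → ℝ) : Prop :=
  Continuous γ ∧ ∃ S : Finset ℝ, ContDiffOn ℝ 1 γ (S : Set ℝ)ᶜ ∧
    ∀ s ∈ S, (∃ l, Tendsto (deriv γ) (𝓝[<] s) (𝓝 l)) ∧ ∃ r, Tendsto (deriv γ) (𝓝[>] s) (𝓝 r)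

/-- The graph of `γ` is a deformation, inside the square `(-a, a)²`, of the line `y = x`. -/
structure IsDeformedLine (a : ℝ) (γ : ℝ → ℝ) : Prop where
  piecewiseC1 : IsPiecewiseC1 γ
  eq_outside : ∀ x, a ≤ |x| → γ x = x
  abs_le_inside : ∀ x, |x| < a → |γ x| ≤ a

/-- The arc length measure of the graph of `γ`, as a measure on the plane: the image of
`√(1 + γ'(x)²) dx` under `x ↦ (x, γ(x))`. -/
def arcLength (γ : ℝ → ℝ) : Measure (ℝ × ℝ) :=
  (volume.withDensity fun x => ENNReal.ofReal √(1 + deriv γ x ^ 2)).map fun x => (x, γ x)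

/-- `τ ∈ L²(Γ)` is the trace of `ψ ∈ H¹(ℝ²)` on the graph `Γ` of `γ`: some test functions
converge to `ψ` in `H¹(ℝ²)` while their restrictions to `Γ` converge to `τ` in `L²(Γ)`. -/
def IsTrace (γ : ℝ → ℝ) (ψ : L2) (τ : Lp ℂ 2 (arcLength γ)) : Prop :=
  ∃ φ : ℕ → ℝ × ℝ → ℂ, (∀ n, ContDiff ℝ ∞ (φ n) ∧ HasCompactSupport (φ n)) ∧
    Tendsto (fun n => eLpNorm (fun p => φ n p - ψ p) 2 volume) atTop (𝓝 0) ∧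
    Tendsto (fun n => eLpNorm (fun p => fderiv ℝ (φ n) p ex - weakDeriv ex ψ p) 2 volume)
      atTop (𝓝 0) ∧
    Tendsto (fun n => eLpNorm (fun p => fderiv ℝ (φ n) p ey - weakDeriv ey ψ p) 2 volume)
      atTop (𝓝 0) ∧
    Tendsto (fun n => eLpNorm (fun p => φ n p - τ p) 2 (arcLength γ)) atTop (𝓝 0)

open Classical in
/-- The trace of `ψ ∈ H¹(ℝ²)` on the graph of `γ`; it exists and is unique when `γ` is
Lipschitz. -/
def trace (γ : ℝ → ℝ) (ψ : L2) : Lp ℂ 2 (arcLength γ) :=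
  if h : ∃ τ, IsTrace γ ψ τ then h.choose else 0

/-! ### The form and the operator -/

/-- The first component of `i∇ψ + Aψ`. -/
def magX (A : ℝ × ℝ → ℝ × ℝ) (ψ : L2) (p : ℝ × ℝ) : ℂ :=
  Complex.I * weakDeriv ex ψ p + ((A p).1 : ℂ) * ψ p

/-- The second component of `i∇ψ + Aψ`. -/
def magY (A : ℝ × ℝ → ℝ × ℝ) (ψ : L2) (p : ℝ × ℝ) : ℂ :=
  Complex.I * weakDeriv ey ψ p + ((A p).2 : ℂ) * ψ p

/-- The sesquilinear form (antilinear in the first argument) whose diagonal is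
`q[ψ] = ∫_{ℝ²} |i∇ψ + Aψ|² dx dy - α ∫_Γ |ψ|² dμ`, on `H¹(ℝ²)`. -/
def form (A : ℝ × ℝ → ℝ × ℝ) (γ : ℝ → ℝ) (α : ℝ) (φ ψ : L2) : ℂ :=
  (∫ p, (star (magX A φ p) * magX A ψ p + star (magY A φ p) * magY A ψ p))
    - α * ∫ p, star (trace γ φ p) * trace γ ψ p ∂(arcLength γ)

/-- The graph of the operator `H = (i∇ + A)² - α δ_Γ` associated with the form:
`ψ ∈ Dom H` and `Hψ = f` if and only if `ψ ∈ H¹(ℝ²)` and `q(φ, ψ) = ⟨φ, f⟩` for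
all `φ ∈ H¹(ℝ²)`. -/
def hamiltonian (A : ℝ × ℝ → ℝ × ℝ) (γ : ℝ → ℝ) (α : ℝ) : Set (L2 × L2) :=
  {u | u.1 ∈ H1 ∧ ∀ φ ∈ H1, form A γ α φ u.1 = inner ℂ φ u.2}

/-- The resolvent set of an (unbounded) operator given by its graph `T`: those `z` for which
`T - z` is a bijection from the domain onto `L²` with a bounded inverse `R`, i.e.
`(T - z)ψ = g` if and only if `ψ = R g`. -/
def resolventSet (T : Set (L2 × L2)) : Set ℂ :=
  {z | ∃ R : L2 →L[ℂ] L2, ∀ ψ g : L2, (ψ, g + z • ψ) ∈ T ↔ ψ = R g}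

/-- The spectrum of an (unbounded) operator given by its graph. -/
def spectrum (T : Set (L2 × L2)) : Set ℂ := (resolventSet T)ᶜ

end LeakyWire

end

/-!
Inside the square `B` forces a magnetic Hardy inequality `∫ |φ|² ≤ K ∫ |(i∇ + A)φ|²`, with `K`
depending on `B` and the square only. If `Y`, the right-hand integral, is small, then by the
diamagnetic and Poincaré inequalities `|φ|` is close to a constant `c`. Choose a test function `χ`
in the square with `∫ Bχ ≠ 0`. Since `B` is the commutator of the two covariant derivatives,
`∫ Bχ|φ|²` is at most `δ ∫ |φ|² + C Y`, whereas it is close to `c² ∫ Bχ`; hence `c²` is `O(Y)` up to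
a small multiple of `∫ |φ|²`. As `B` is only locally integrable, `∫ Bχ(|φ|² - c²)` is estimated by
writing `B` as the curl of a potential which acts boundedly from `H¹` to `L²`.

For small `α` the Hardy inequality absorbs `α ∫ |φ|² dμ` over the part of `Γ` in the square; the
threshold on `γ'` says that `α √(1 + γ'²) ≤ √2 α₀`. Outside the square `Γ` is the line `y = x`, and
there the one-dimensional bound for a `δ` interaction along the antidiagonals costs `α² / 4`. The
form minus `lam < -α² / 4` is therefore coercive on `H¹`, hence represented by an invertible
operator, which yields the resolvent at `lam`.
-/

open scoped Convolution Distributions NNReal LineDeriv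
open ContinuousLinearMap (lsmul)
open TopologicalSpace (Opens)

noncomputable section

namespace LeakyWire

section Approximation

variable {E F : Type*} [NormedAddCommGroup E] [NormedAddCommGroup F]
  [MeasurableSpace E] [BorelSpace E] {μ : Measure E} {p : ℝ≥0∞}

theorem tendsto_eLpNorm_zero_of_dominated {α G : Type*} [MeasurableSpace α] {ν : Measure α}
    [NormedAddCommGroup G] (hp0 : p ≠ 0) (hp : p ≠ ⊤) {u : ℕ → α → F} {g : α → G}
    (hu : ∀ n, AEStronglyMeasurable (u n) ν) (hg : MemLp g p ν)
    (hle : ∀ n x, ‖u n x‖ ≤ ‖g x‖) (hlim : ∀ x, Tendsto (fun n => u n x) atTop (𝓝 0)) :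
    Tendsto (fun n => eLpNorm (u n) p ν) atTop (𝓝 0) := by
  have hp' : 0 < p.toReal := ENNReal.toReal_pos hp0 hp
  have hlintegral : Tendsto (fun n => ∫⁻ x, ‖u n x‖ₑ ^ p.toReal ∂ν) atTop (𝓝 (∫⁻ _, 0 ∂ν)) := by
    refine tendsto_lintegral_of_dominated_convergence' (fun x => ‖g x‖ₑ ^ p.toReal)
      (fun n => (hu n).enorm.pow_const _) (fun n => ae_of_all _ fun x => ?_)
      (lintegral_rpow_enorm_lt_top_of_eLpNorm_lt_top hp0 hp hg.2).ne (ae_of_all _ fun x => ?_)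
    · exact ENNReal.rpow_le_rpow (enorm_le_iff_norm_le.2 (hle n x)) hp'.le
    · have h := (ENNReal.continuous_rpow_const (y := p.toReal)).tendsto _ |>.comp (hlim x).enorm
      rwa [enorm_zero, ENNReal.zero_rpow_of_pos hp'] at h
  have h := (ENNReal.continuous_rpow_const (y := 1 / p.toReal)).tendsto _ |>.comp hlintegral
  rw [lintegral_zero, ENNReal.zero_rpow_of_pos (one_div_pos.2 hp')] at h
  exact h.congr fun n => (eLpNorm_eq_lintegral_rpow_enorm_toReal hp0 hp).symm

theorem tendsto_eLpNorm_translate_sub [ProperSpace E] [μ.IsAddHaarMeasure]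
    [Fact (1 ≤ p)] (hp : p ≠ ⊤) (f : Lp F p μ) :
    Tendsto (fun t : E => eLpNorm (fun x => f (x - t) - f x) p μ) (𝓝 0) (𝓝 0) := by
  let G : C(E, C(E, E)) := ContinuousMap.curry ⟨fun q : E × E => q.2 - q.1, by fun_prop⟩
  have hG (t : E) : MeasurePreserving (G t) μ μ := measurePreserving_sub_right μ t
  have h := Tendsto.compMeasurePreservingLp (tendsto_const_nhds (x := f)) (G.continuous.tendsto 0)
    hG (hG 0) hp
  rw [Lp.tendsto_Lp_iff_tendsto_eLpNorm'] at h
  refine h.congr fun t => eLpNorm_congr_ae ?_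
  filter_upwards [Lp.coeFn_compMeasurePreserving f (hG t),
    Lp.coeFn_compMeasurePreserving f (hG 0)] with x hx hx0
  rw [Pi.sub_apply, hx, hx0]
  simp [G]

variable [NormedSpace ℝ E] [FiniteDimensional ℝ E] [NormedSpace ℝ F] [CompleteSpace F]
  [μ.IsAddHaarMeasure] {ρ : E → ℝ}

theorem enorm_convolution_sub_rpow_le {q : ℝ≥0} (hq : 1 ≤ q) (hρ : Continuous ρ)
    (hc : HasCompactSupport ρ) (h0 : ∀ t, 0 ≤ ρ t) (h1 : ∫ t, ρ t ∂μ = 1) {f : E → F}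
    (hfm : StronglyMeasurable f) (hf : LocallyIntegrable f μ) (x : E) :
    ‖(ρ ⋆[lsmul ℝ ℝ, μ] f) x - f x‖ₑ ^ (q : ℝ) ≤
      ∫⁻ t, ENNReal.ofReal (ρ t) * ‖f (x - t) - f x‖ₑ ^ (q : ℝ) ∂μ := by
  have hρi : Integrable ρ μ := hρ.integrable_of_hasCompactSupport hc
  have hρm : Measurable fun t => ENNReal.ofReal (ρ t) := hρ.measurable.ennreal_ofReal
  set ν := μ.withDensity fun t => ENNReal.ofReal (ρ t)
  have hν : IsProbabilityMeasure ν := ⟨by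
    rw [withDensity_apply _ MeasurableSet.univ, Measure.restrict_univ,
      ← ofReal_integral_eq_lintegral_ofReal hρi (ae_of_all _ h0), h1, ENNReal.ofReal_one]⟩
  have hm : StronglyMeasurable fun t => f (x - t) - f x :=
    (hfm.comp_measurable (measurable_const.sub measurable_id)).sub stronglyMeasurable_const
  have hdiff : (ρ ⋆[lsmul ℝ ℝ, μ] f) x - f x = ∫ t, ρ t • (f (x - t) - f x) ∂μ := by
    have hex : Integrable (fun t => ρ t • f (x - t)) μ :=
      hc.convolutionExists_left (lsmul ℝ ℝ) hρ hf x
    simp only [smul_sub]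
    rw [integral_sub hex (hρi.smul_const _), integral_smul_const, h1, one_smul]
    rfl
  calc ‖(ρ ⋆[lsmul ℝ ℝ, μ] f) x - f x‖ₑ ^ (q : ℝ)
      ≤ (∫⁻ t, ENNReal.ofReal (ρ t) * ‖f (x - t) - f x‖ₑ ∂μ) ^ (q : ℝ) := by
        rw [hdiff]
        refine ENNReal.rpow_le_rpow ((enorm_integral_le_lintegral_enorm _).trans_eq ?_) q.2
        simp only [enorm_smul, Real.enorm_of_nonneg (h0 _)]
    _ = eLpNorm (fun t => f (x - t) - f x) 1 ν ^ (q : ℝ) := by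
        rw [eLpNorm_one_eq_lintegral_enorm,
          lintegral_withDensity_eq_lintegral_mul _ hρm hm.enorm]
        rfl
    _ ≤ eLpNorm (fun t => f (x - t) - f x) q ν ^ (q : ℝ) :=
        ENNReal.rpow_le_rpow (eLpNorm_le_eLpNorm_of_exponent_le (mod_cast hq)
          hm.aestronglyMeasurable) q.2
    _ = _ := by
        rw [eLpNorm_nnreal_pow_eq_lintegral (by positivity),
          lintegral_withDensity_eq_lintegral_mul _ hρm (hm.enorm.pow_const _)]
        rfl

theorem eLpNorm_convolution_sub_le [Fact (1 ≤ p)] (hp : p ≠ ⊤) (hρ : Continuous ρ)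
    (hc : HasCompactSupport ρ) (h0 : ∀ t, 0 ≤ ρ t) (h1 : ∫ t, ρ t ∂μ = 1) (f : Lp F p μ)
    {ε : ℝ≥0∞} (hε : ∀ t ∈ Function.support ρ, eLpNorm (fun x => f (x - t) - f x) p μ ≤ ε) :
    eLpNorm (fun x => (ρ ⋆[lsmul ℝ ℝ, μ] f) x - f x) p μ ≤ ε := by
  have hp1 : 1 ≤ p := Fact.out
  have hf : LocallyIntegrable f μ := (Lp.memLp f).locallyIntegrable hp1
  lift p to ℝ≥0 using hp
  replace hp1 : 1 ≤ p := mod_cast hp1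
  have hp0 : p ≠ 0 := (zero_lt_one.trans_le hp1).ne'
  have hfm : StronglyMeasurable f := Lp.stronglyMeasurable f
  have hρm : Measurable fun t => ENNReal.ofReal (ρ t) := hρ.measurable.ennreal_ofReal
  have hm (t : E) : StronglyMeasurable fun x => f (x - t) - f x :=
    (hfm.comp_measurable (measurable_id.sub measurable_const)).sub hfm
  rw [← ENNReal.rpow_le_rpow_iff (z := p) (by positivity), eLpNorm_nnreal_pow_eq_lintegral hp0]
  calc ∫⁻ x, ‖(ρ ⋆[lsmul ℝ ℝ, μ] f) x - f x‖ₑ ^ (p : ℝ) ∂μ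
      ≤ ∫⁻ x, ∫⁻ t, ENNReal.ofReal (ρ t) * ‖f (x - t) - f x‖ₑ ^ (p : ℝ) ∂μ ∂μ :=
        lintegral_mono fun x => enorm_convolution_sub_rpow_le hp1 hρ hc h0 h1 hfm hf x
    _ = ∫⁻ t, ∫⁻ x, ENNReal.ofReal (ρ t) * ‖f (x - t) - f x‖ₑ ^ (p : ℝ) ∂μ ∂μ :=
        lintegral_lintegral_swap <| Measurable.aemeasurable <|
          (hρm.comp measurable_snd).mul <| ((hfm.comp_measurable
            (measurable_fst.sub measurable_snd)).sub
              (hfm.comp_measurable measurable_fst)).enorm.pow_const _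
    _ ≤ ∫⁻ t, ENNReal.ofReal (ρ t) * ε ^ (p : ℝ) ∂μ := by
        refine lintegral_mono fun t => ?_
        rw [lintegral_const_mul _ ((hm t).enorm.pow_const _),
          ← eLpNorm_nnreal_pow_eq_lintegral hp0 (f := fun x => f (x - t) - f x)]
        by_cases ht : t ∈ Function.support ρ
        · gcongr
          exact hε t ht
        · simp [Function.notMem_support.1 ht]
    _ = ε ^ (p : ℝ) := by
        rw [lintegral_mul_const _ hρm, ← ofReal_integral_eq_lintegral_ofReal
          (hρ.integrable_of_hasCompactSupport hc) (ae_of_all _ h0), h1, ENNReal.ofReal_one,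
          one_mul]

theorem memLp_convolution [Fact (1 ≤ p)] (hp : p ≠ ⊤) (hρ : ContDiff ℝ ∞ ρ)
    (hc : HasCompactSupport ρ) (h0 : ∀ t, 0 ≤ ρ t) (h1 : ∫ t, ρ t ∂μ = 1) (f : Lp F p μ) :
    MemLp (ρ ⋆[lsmul ℝ ℝ, μ] f) p μ := by
  have hfm := Lp.aestronglyMeasurable f
  have hsub : MemLp (fun x => (ρ ⋆[lsmul ℝ ℝ, μ] f) x - f x) p μ := by
    refine ⟨(hc.contDiff_convolution_left (lsmul ℝ ℝ) hρ ((Lp.memLp f).locallyIntegrable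
      Fact.out)).continuous.aestronglyMeasurable.sub hfm, ?_⟩
    refine (eLpNorm_convolution_sub_le hp hρ.continuous hc h0 h1 f
      (ε := eLpNorm f p μ + eLpNorm f p μ) fun t _ => ?_).trans_lt
      (ENNReal.add_lt_top.2 ⟨Lp.eLpNorm_lt_top f, Lp.eLpNorm_lt_top f⟩)
    have hmp := measurePreserving_sub_right μ t
    exact (eLpNorm_sub_le (hfm.comp_measurePreserving hmp) hfm Fact.out).trans_eq
      (by rw [eLpNorm_comp_measurePreserving hfm hmp])
  simpa [Pi.add_def] using hsub.add (Lp.memLp f)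

theorem tendsto_eLpNorm_convolution_sub [Fact (1 ≤ p)] (hp : p ≠ ⊤) (f : Lp F p μ)
    {ι : Type*} {l : Filter ι} {φ : ι → ContDiffBump (0 : E)}
    (hφ : Tendsto (fun i => (φ i).rOut) l (𝓝 0)) :
    Tendsto (fun i => eLpNorm (fun x => ((φ i).normed μ ⋆[lsmul ℝ ℝ, μ] f) x - f x) p μ)
      l (𝓝 0) := by
  refine ENNReal.tendsto_nhds_zero.2 fun ε hε => ?_
  obtain ⟨δ, hδ, h⟩ := Metric.eventually_nhds_iff.1
    ((tendsto_order.1 (tendsto_eLpNorm_translate_sub hp f)).2 ε hε)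
  filter_upwards [hφ.eventually_lt_const hδ] with i hi
  refine eLpNorm_convolution_sub_le hp (φ i).continuous_normed (φ i).hasCompactSupport_normed
    (φ i).nonneg_normed (φ i).integral_normed f fun t ht => (h ?_).le
  rw [(φ i).support_normed_eq, Metric.mem_ball] at ht
  exact ht.trans hi

end Approximation

section WeakDerivative

variable {E F : Type*} [NormedAddCommGroup E] [NormedSpace ℝ E] [NormedAddCommGroup F]
  [NormedSpace ℝ F]

theorem contDiff_fderiv_apply {f : E → F} (hf : ContDiff ℝ ∞ f) (v : E) :
    ContDiff ℝ ∞ fun x => fderiv ℝ f x v :=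
  (hf.fderiv_right (m := ∞) (by simp)).clm_apply contDiff_const

variable [MeasurableSpace E] {μ : Measure E}

/-- `g` is the weak derivative of `f` in the direction `v`, with respect to the measure `μ`. For
`f`, `g` in `L²(ℝ²)` and Lebesgue measure this is `IsWeakDeriv`. -/
def HasWeakDeriv (μ : Measure E) (v : E) (f g : E → F) : Prop :=
  ∀ φ : E → ℝ, ContDiff ℝ ∞ φ → HasCompactSupport φ →
    ∫ x, fderiv ℝ φ x v • f x ∂μ = - ∫ x, φ x • g x ∂μ

variable [BorelSpace E] [FiniteDimensional ℝ E]

theorem HasWeakDeriv.ae_eq [CompleteSpace F] {v : E} {f g g' : E → F}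
    (h : HasWeakDeriv μ v f g) (h' : HasWeakDeriv μ v f g') (hg : LocallyIntegrable g μ)
    (hg' : LocallyIntegrable g' μ) : g =ᵐ[μ] g' :=
  ae_eq_of_integral_contDiff_smul_eq hg hg' fun φ hφ hc =>
    neg_inj.1 ((h φ hφ hc).symm.trans (h' φ hφ hc))

variable [μ.IsAddHaarMeasure]

theorem hasWeakDeriv_fderiv {f : E → F} (hf : ContDiff ℝ 1 f) (v : E) :
    HasWeakDeriv μ v f fun x => fderiv ℝ f x v := by
  intro φ hφ hc
  have hprod {u : E → ℝ} {w : E → F} (hu : Continuous u) (huc : HasCompactSupport u)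
      (hw : Continuous w) : Integrable (fun x => u x • w x) μ :=
    (hu.smul hw).integrable_of_hasCompactSupport huc.smul_right
  rw [integral_smul_fderiv_eq_neg_fderiv_smul_of_integrable
    (hprod (contDiff_fderiv_apply hφ v).continuous (hc.fderiv_apply ℝ v) hf.continuous)
    (hprod hφ.continuous hc (hf.continuous_fderiv_apply (by simp) |>.comp (continuous_id.prodMk
      continuous_const)))
    (hprod hφ.continuous hc hf.continuous) (fun x _ => hφ.differentiable (by simp) x)
    (fun x _ => hf.differentiable (by simp) x), neg_neg]

theorem HasWeakDeriv.fderiv_convolution {v : E} {f g : E → F} (h : HasWeakDeriv μ v f g)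
    (hf : LocallyIntegrable f μ) {ρ : E → ℝ} (hρ : ContDiff ℝ ∞ ρ) (hc : HasCompactSupport ρ)
    (x : E) : fderiv ℝ (ρ ⋆[lsmul ℝ ℝ, μ] f) x v = (ρ ⋆[lsmul ℝ ℝ, μ] g) x := by
  have hfderiv : fderiv ℝ (ρ ⋆[lsmul ℝ ℝ, μ] f) x v = ∫ t, fderiv ℝ ρ t v • f (x - t) ∂μ := by
    rw [(hc.hasFDerivAt_convolution_left (lsmul ℝ ℝ) (hρ.of_le (by simp)) hf x).fderiv,
      convolution, ContinuousLinearMap.integral_apply ((hc.fderiv ℝ).convolutionExists_left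
        ((lsmul ℝ ℝ : ℝ →L[ℝ] F →L[ℝ] F).precompL E) (hρ.continuous_fderiv (by simp)) hf x)]
    simp [ContinuousLinearMap.precompL_apply]
  have hreflect (s : E) : fderiv ℝ (fun s => ρ (x - s)) s v = -fderiv ℝ ρ (x - s) v := by
    have := (hρ.differentiable (by simp) (x - s)).hasFDerivAt.comp s
      ((hasFDerivAt_id s).const_sub x)
    simp [show fderiv ℝ (fun s => ρ (x - s)) s = _ from this.fderiv]
  have hweak := h (fun s => ρ (x - s)) (hρ.comp (contDiff_const.sub contDiff_id))
    (hc.comp_homeomorph (Homeomorph.subLeft x))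
  simp only [hreflect, neg_smul, integral_neg, neg_inj] at hweak
  calc fderiv ℝ (ρ ⋆[lsmul ℝ ℝ, μ] f) x v = ∫ s, fderiv ℝ ρ (x - s) v • f s ∂μ := by
        rw [hfderiv, ← integral_sub_left_eq_self _ μ x]
        simp only [sub_sub_cancel]
    _ = ∫ s, ρ (x - s) • g s ∂μ := hweak
    _ = (ρ ⋆[lsmul ℝ ℝ, μ] g) x := by
        rw [← integral_sub_left_eq_self _ μ x]
        simp only [sub_sub_cancel]
        rfl

end WeakDerivative

section Cutoff

variable {E F : Type*} [NormedAddCommGroup E] [NormedSpace ℝ E] [FiniteDimensional ℝ E]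
  [NormedAddCommGroup F] [NormedSpace ℝ F]

/-- A smooth cutoff function at the scale `n + 1`. -/
def cutoff (n : ℕ) (x : E) : ℝ :=
  (⟨1, 2, one_pos, one_lt_two⟩ : ContDiffBump (0 : E)) (((n : ℝ) + 1)⁻¹ • x)

theorem contDiff_cutoff (n : ℕ) : ContDiff ℝ ∞ (cutoff n : E → ℝ) :=
  (ContDiffBump.contDiff _).comp (contDiff_const_smul _)

theorem hasCompactSupport_cutoff (n : ℕ) : HasCompactSupport (cutoff n : E → ℝ) :=
  (ContDiffBump.hasCompactSupport _).comp_smul (by positivity)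

theorem norm_cutoff_sub_one_le (n : ℕ) (x : E) : ‖cutoff n x - 1‖ ≤ 1 := by
  have h0 : 0 ≤ cutoff n x := ContDiffBump.nonneg _
  have h1 : cutoff n x ≤ 1 := ContDiffBump.le_one _
  rw [Real.norm_eq_abs, abs_le]
  constructor <;> linarith

theorem tendsto_cutoff (x : E) : Tendsto (fun n => cutoff n x) atTop (𝓝 1) := by
  refine tendsto_const_nhds.congr' ?_
  filter_upwards [tendsto_natCast_atTop_atTop.eventually_ge_atTop ‖x‖] with n hn
  refine (ContDiffBump.one_of_mem_closedBall _ ?_).symm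
  rw [mem_closedBall_zero_iff, norm_smul, norm_inv, Real.norm_of_nonneg (by positivity)]
  change _ ≤ (1 : ℝ)
  rw [inv_mul_le_iff₀ (by positivity)]
  linarith

theorem exists_norm_fderiv_cutoff_le :
    ∃ C : ℝ, ∀ (n : ℕ) (x : E), ‖fderiv ℝ (cutoff n) x‖ ≤ ((n : ℝ) + 1)⁻¹ * C := by
  set b : ContDiffBump (0 : E) := ⟨1, 2, one_pos, one_lt_two⟩
  obtain ⟨C, hC⟩ := (b.contDiff.continuous_fderiv (n := ∞)
    (by simp)).bounded_above_of_compact_support (b.hasCompactSupport.fderiv ℝ)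
  refine ⟨C, fun n x => ?_⟩
  rw [show (cutoff n : E → ℝ) = fun x => b (((n : ℝ) + 1)⁻¹ • x) from rfl, fderiv_comp_smul,
    norm_smul, norm_inv, Real.norm_of_nonneg (by positivity)]
  gcongr
  exact hC _

variable [MeasurableSpace E] {μ : Measure E} {p : ℝ≥0∞}

theorem tendsto_eLpNorm_fderiv_cutoff_smul {f : E → F} (hf : MemLp f p μ) (v : E) :
    Tendsto (fun n => eLpNorm (fun x => fderiv ℝ (cutoff n) x v • f x) p μ) atTop (𝓝 0) := by
  obtain ⟨C, hC⟩ := exists_norm_fderiv_cutoff_le (E := E)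
  have hle (n : ℕ) : eLpNorm (fun x => fderiv ℝ (cutoff n) x v • f x) p μ ≤
      ENNReal.ofReal (((n : ℝ) + 1)⁻¹ * C * ‖v‖) * eLpNorm f p μ :=
    eLpNorm_le_mul_eLpNorm_of_ae_le_mul (ae_of_all _ fun x => by
      rw [norm_smul]
      gcongr
      exact (ContinuousLinearMap.le_opNorm _ v).trans (by gcongr; exact hC n x)) p
  have hlim : Tendsto (fun n : ℕ => ((n : ℝ) + 1)⁻¹ * C * ‖v‖) atTop (𝓝 0) := by
    simpa using ((tendsto_one_div_add_atTop_nhds_zero_nat (𝕜 := ℝ)).mul_const C).mul_const ‖v‖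
  refine tendsto_of_tendsto_of_tendsto_of_le_of_le tendsto_const_nhds ?_ (fun _ => zero_le) hle
  simpa using ENNReal.Tendsto.mul_const (ENNReal.tendsto_ofReal hlim) (Or.inr hf.2.ne)

variable [BorelSpace E]

theorem tendsto_eLpNorm_cutoff_smul_sub (hp0 : p ≠ 0) (hp : p ≠ ⊤) {f : E → F}
    (hf : MemLp f p μ) :
    Tendsto (fun n => eLpNorm (fun x => cutoff n x • f x - f x) p μ) atTop (𝓝 0) := by
  refine tendsto_eLpNorm_zero_of_dominated hp0 hp (fun n => ?_) hf (fun n x => ?_) fun x => ?_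
  · exact ((contDiff_cutoff n).continuous.aestronglyMeasurable.smul hf.1).sub hf.1
  · rw [show cutoff n x • f x - f x = (cutoff n x - 1) • f x by rw [sub_smul, one_smul], norm_smul]
    exact mul_le_of_le_one_left (norm_nonneg _) (norm_cutoff_sub_one_le n x)
  · simpa using ((tendsto_cutoff x).smul_const (f x)).sub_const (f x)

theorem tendsto_eLpNorm_fderiv_cutoff_smul_sub (hp1 : 1 ≤ p) (hp : p ≠ ⊤) {f : E → F}
    (hs : ContDiff ℝ ∞ f) {v : E} (hf : MemLp f p μ) (hg : MemLp (fun x => fderiv ℝ f x v) p μ) :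
    Tendsto (fun n => eLpNorm
      (fun x => fderiv ℝ (fun x => cutoff n x • f x) x v - fderiv ℝ f x v) p μ) atTop (𝓝 0) := by
  have hsum := (tendsto_eLpNorm_cutoff_smul_sub (zero_lt_one.trans_le hp1).ne' hp hg).add
    (tendsto_eLpNorm_fderiv_cutoff_smul hf v)
  rw [add_zero] at hsum
  refine tendsto_of_tendsto_of_tendsto_of_le_of_le tendsto_const_nhds hsum (fun _ => zero_le)
    fun n => ?_
  have hleibniz : (fun x => fderiv ℝ (fun x => cutoff n x • f x) x v - fderiv ℝ f x v) =
      (fun x => cutoff n x • fderiv ℝ f x v - fderiv ℝ f x v) +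
        fun x => fderiv ℝ (cutoff n) x v • f x := by
    ext x
    rw [fderiv_fun_smul ((contDiff_cutoff n).differentiable (by simp) x)
      (hs.differentiable (by simp) x)]
    simp [sub_add_eq_add_sub]
  rw [hleibniz]
  exact eLpNorm_add_le (((contDiff_cutoff n).continuous.aestronglyMeasurable.smul hg.1).sub hg.1)
    ((contDiff_fderiv_apply (contDiff_cutoff n) v).continuous.aestronglyMeasurable.smul hf.1) hp1

end Cutoff

section TestFunctions

theorem lineDerivOp_apply {E F : Type*} [NormedAddCommGroup E] [NormedSpace ℝ E]
    [NormedAddCommGroup F] [NormedSpace ℝ F] {Ω : Opens E} (φ : 𝓓(Ω, F)) (v x : E) :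
    ∂_{v} φ x = fderiv ℝ φ x v := by
  rw [TestFunction.lineDerivOp_eq_lineDerivCLM ℝ,
    TestFunction.lineDerivCLM_apply_of_le (𝕜 := ℝ) (by simp)]
  exact (φ.contDiff.differentiable (by simp) x).lineDeriv_eq_fderiv

/-- The test functions `C_c^∞(ℝ²; F)`. -/
abbrev Test (F : Type*) [NormedAddCommGroup F] [NormedSpace ℝ F] : Type _ :=
  𝓓((⊤ : Opens (ℝ × ℝ)), F)

/-- A real test function, seen as a complex one. -/
def testOfReal (η : Test ℝ) : Test ℂ := TestFunction.postcompCLM Complex.ofRealCLM η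

@[simp] theorem testOfReal_apply (η : Test ℝ) (p : ℝ × ℝ) : testOfReal η p = η p := rfl

variable (μ : Measure (ℝ × ℝ)) [IsFiniteMeasureOnCompacts μ]

theorem memLp_test (φ : Test ℂ) : MemLp φ 2 μ :=
  φ.continuous.memLp_of_hasCompactSupport φ.hasCompactSupport

/-- The class in `L²(μ)` of a test function. -/
def testToLp : Test ℂ →ₗ[ℂ] Lp ℂ 2 μ where
  toFun φ := (memLp_test μ φ).toLp φ
  map_add' φ χ := MemLp.toLp_add (memLp_test μ φ) (memLp_test μ χ)
  map_smul' c φ := MemLp.toLp_const_smul c (memLp_test μ φ)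

theorem coeFn_testToLp (φ : Test ℂ) : testToLp μ φ =ᵐ[μ] φ := (memLp_test μ φ).coeFn_toLp

theorem tendsto_testToLp_iff {ι : Type*} {l : Filter ι} (φ : ι → Test ℂ) (ψ : Lp ℂ 2 μ) :
    Tendsto (fun n => testToLp μ (φ n)) l (𝓝 ψ) ↔
      Tendsto (fun n => eLpNorm (fun p => φ n p - ψ p) 2 μ) l (𝓝 0) := by
  rw [Lp.tendsto_Lp_iff_tendsto_eLpNorm']
  refine tendsto_congr fun n => eLpNorm_congr_ae ?_
  filter_upwards [coeFn_testToLp μ (φ n)] with p hp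
  simp [hp]

theorem integral_smul_eq_inner_testToLp (η : Test ℝ) (ψ : Lp ℂ 2 μ) :
    ∫ p, η p • ψ p ∂μ = inner ℂ (testToLp μ (testOfReal η)) ψ := by
  rw [L2.inner_def]
  refine integral_congr_ae ?_
  filter_upwards [coeFn_testToLp μ (testOfReal η)] with p hp
  simp [hp, mul_comm]

end TestFunctions

section Sobolev

theorem isWeakDeriv_iff {v : ℝ × ℝ} {ψ g : L2} :
    IsWeakDeriv v ψ g ↔ ∀ η : Test ℝ, inner ℂ (testToLp volume (testOfReal (∂_{v} η))) ψ
      + inner ℂ (testToLp volume (testOfReal η)) g = 0 := by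
  simp only [← integral_smul_eq_inner_testToLp, lineDerivOp_apply, add_eq_zero_iff_eq_neg]
  exact ⟨fun h η => h η η.contDiff η.hasCompactSupport,
    fun h φ hφ hc => h ⟨φ, hφ, hc, subset_univ _⟩⟩

theorem IsWeakDeriv.weakDeriv_eq {v : ℝ × ℝ} {ψ g : L2} (h : IsWeakDeriv v ψ g) :
    weakDeriv v ψ = g := by
  have hex : ∃ g, IsWeakDeriv v ψ g := ⟨g, h⟩
  rw [weakDeriv, dif_pos hex]
  exact Lp.ext (HasWeakDeriv.ae_eq hex.choose_spec h
    ((Lp.memLp _).locallyIntegrable one_le_two) ((Lp.memLp _).locallyIntegrable one_le_two))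

theorem isWeakDeriv_of_contDiff {v : ℝ × ℝ} {f : ℝ × ℝ → ℂ} (hf : ContDiff ℝ 1 f) {ψ g : L2}
    (hψ : ψ =ᵐ[volume] f) (hg : g =ᵐ[volume] fun p => fderiv ℝ f p v) : IsWeakDeriv v ψ g := by
  intro η hη hc
  calc ∫ p, fderiv ℝ η p v • ψ p = ∫ p, fderiv ℝ η p v • f p :=
        integral_congr_ae (hψ.mono fun p hp => by simp only [hp])
    _ = -∫ p, η p • fderiv ℝ f p v := hasWeakDeriv_fderiv hf v η hη hc
    _ = -∫ p, η p • g p :=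
        congrArg _ (integral_congr_ae (hg.mono fun p hp => by simp only [hp]))

theorem coeFn_testToLp_lineDeriv (v : ℝ × ℝ) (φ : Test ℂ) :
    testToLp volume (∂_{v} φ) =ᵐ[volume] fun p => fderiv ℝ φ p v := by
  filter_upwards [coeFn_testToLp volume (∂_{v} φ)] with p hp using hp.trans (lineDerivOp_apply ..)

theorem isWeakDeriv_testToLp (v : ℝ × ℝ) (φ : Test ℂ) :
    IsWeakDeriv v (testToLp volume φ) (testToLp volume (∂_{v} φ)) :=
  isWeakDeriv_of_contDiff (φ.contDiff.of_le (by simp)) (coeFn_testToLp volume φ)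
    (coeFn_testToLp_lineDeriv v φ)

/-- The graph of the weak derivative in the direction `v`, as a subspace of `L² × L²`. -/
def weakDerivGraph (v : ℝ × ℝ) : Submodule ℂ (L2 × L2) :=
  ⨅ η : Test ℝ, ((innerSL ℂ (testToLp volume (testOfReal (∂_{v} η)))).coprod
    (innerSL ℂ (testToLp volume (testOfReal η)))).ker

theorem mem_weakDerivGraph {v : ℝ × ℝ} {u : L2 × L2} :
    u ∈ weakDerivGraph v ↔ IsWeakDeriv v u.1 u.2 := by
  simp [weakDerivGraph, isWeakDeriv_iff]

theorem isClosed_weakDerivGraph (v : ℝ × ℝ) : IsClosed (weakDerivGraph v : Set (L2 × L2)) := by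
  rw [weakDerivGraph, Submodule.coe_iInf]
  exact isClosed_iInter fun η => ContinuousLinearMap.isClosed_ker _

/-- The Hilbert space of triples `(ψ, ∂ₓψ, ∂_yψ)` with `ψ ∈ H¹(ℝ²)`. -/
def sobolev : Submodule ℂ (PiLp 2 fun _ : Fin 3 => L2) :=
  let proj (i : Fin 3) : (PiLp 2 fun _ : Fin 3 => L2) →L[ℂ] L2 := PiLp.proj 2 _ i
  (weakDerivGraph ex).comap ((proj 0).prod (proj 1)).toLinearMap ⊓
    (weakDerivGraph ey).comap ((proj 0).prod (proj 2)).toLinearMap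

theorem mem_sobolev {u : PiLp 2 fun _ : Fin 3 => L2} :
    u ∈ sobolev ↔ IsWeakDeriv ex (u 0) (u 1) ∧ IsWeakDeriv ey (u 0) (u 2) :=
  and_congr (mem_weakDerivGraph (u := (u 0, u 1))) (mem_weakDerivGraph (u := (u 0, u 2)))

instance : CompleteSpace sobolev :=
  (((isClosed_weakDerivGraph ex).preimage (ContinuousLinearMap.continuous _)).inter
    ((isClosed_weakDerivGraph ey).preimage (ContinuousLinearMap.continuous _))).completeSpace_coe

/-- The coordinates `ψ`, `∂ₓψ`, `∂_yψ` of an element of `H¹(ℝ²)`. -/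
def coord (i : Fin 3) : sobolev →L[ℂ] L2 := (PiLp.proj 2 _ i).comp sobolev.subtypeL

theorem sobolev_norm_sq (u : sobolev) :
    ‖u‖ ^ 2 = ‖coord 0 u‖ ^ 2 + ‖coord 1 u‖ ^ 2 + ‖coord 2 u‖ ^ 2 := by
  change ‖(u : PiLp 2 fun _ : Fin 3 => L2)‖ ^ 2 = _
  rw [PiLp.norm_sq_eq_of_L2, Fin.sum_univ_three]
  rfl

theorem isWeakDeriv_coord_one (u : sobolev) : IsWeakDeriv ex (coord 0 u) (coord 1 u) :=
  (mem_sobolev.1 u.2).1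

theorem isWeakDeriv_coord_two (u : sobolev) : IsWeakDeriv ey (coord 0 u) (coord 2 u) :=
  (mem_sobolev.1 u.2).2

theorem coord_zero_mem_H1 (u : sobolev) : coord 0 u ∈ H1 :=
  ⟨⟨_, isWeakDeriv_coord_one u⟩, ⟨_, isWeakDeriv_coord_two u⟩⟩

theorem exists_coord_zero_eq {ψ : L2} (h : ψ ∈ H1) : ∃ u : sobolev, coord 0 u = ψ := by
  obtain ⟨⟨g, hg⟩, ⟨k, hk⟩⟩ := h
  exact ⟨⟨WithLp.toLp 2 ![ψ, g, k], mem_sobolev.2 ⟨hg, hk⟩⟩, rfl⟩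

theorem weakDeriv_ex_coord (u : sobolev) : weakDeriv ex (coord 0 u) = coord 1 u :=
  (isWeakDeriv_coord_one u).weakDeriv_eq

theorem weakDeriv_ey_coord (u : sobolev) : weakDeriv ey (coord 0 u) = coord 2 u :=
  (isWeakDeriv_coord_two u).weakDeriv_eq

theorem coord_zero_injective : Function.Injective (coord 0) := by
  intro u w h
  ext i : 2
  fin_cases i
  · exact h
  · change coord 1 u = coord 1 w
    rw [← weakDeriv_ex_coord, h, weakDeriv_ex_coord]
  · change coord 2 u = coord 2 w
    rw [← weakDeriv_ey_coord, h, weakDeriv_ey_coord]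

/-- The embedding of the test functions into `H¹(ℝ²)`. -/
def testToSobolev : Test ℂ →ₗ[ℂ] sobolev where
  toFun φ := ⟨WithLp.toLp 2 ![testToLp volume φ, testToLp volume (∂_{ex} φ),
    testToLp volume (∂_{ey} φ)],
      mem_sobolev.2 ⟨isWeakDeriv_testToLp ex φ, isWeakDeriv_testToLp ey φ⟩⟩
  map_add' φ χ := coord_zero_injective (map_add (testToLp volume) φ χ)
  map_smul' c φ := coord_zero_injective (map_smul (testToLp volume) c φ)

@[simp] theorem coord_zero_testToSobolev (φ : Test ℂ) :
    coord 0 (testToSobolev φ) = testToLp volume φ := rfl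

@[simp] theorem coord_one_testToSobolev (φ : Test ℂ) :
    coord 1 (testToSobolev φ) = testToLp volume (∂_{ex} φ) := rfl

@[simp] theorem coord_two_testToSobolev (φ : Test ℂ) :
    coord 2 (testToSobolev φ) = testToLp volume (∂_{ey} φ) := rfl

theorem tendsto_sobolev_iff {ι : Type*} {l : Filter ι} {w : ι → sobolev} {u : sobolev} :
    Tendsto w l (𝓝 u) ↔ ∀ i, Tendsto (fun n => coord i (w n)) l (𝓝 (coord i u)) := by
  refine ⟨fun h i => ((coord i).continuous.tendsto u).comp h, fun h => ?_⟩
  exact tendsto_subtype_rng.2 (((PiLp.homeomorph 2 _).isInducing.tendsto_nhds_iff).2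
    (tendsto_pi_nhds.2 h))

theorem tendsto_testToSobolev_iff {ι : Type*} {l : Filter ι} (φ : ι → Test ℂ) (u : sobolev) :
    Tendsto (fun n => testToSobolev (φ n)) l (𝓝 u) ↔
      Tendsto (fun n => eLpNorm (fun p => φ n p - coord 0 u p) 2 volume) l (𝓝 0) ∧
      Tendsto (fun n => eLpNorm (fun p => fderiv ℝ (φ n) p ex - coord 1 u p) 2 volume) l (𝓝 0) ∧
      Tendsto (fun n => eLpNorm (fun p => fderiv ℝ (φ n) p ey - coord 2 u p) 2 volume) l
        (𝓝 0) := by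
  rw [tendsto_sobolev_iff, Fin.forall_fin_succ, Fin.forall_fin_two]
  have hd (v : ℝ × ℝ) (g : L2) := tendsto_testToLp_iff (l := l) volume (fun n => ∂_{v} (φ n)) g
  simp only [lineDerivOp_apply] at hd
  exact and_congr (tendsto_testToLp_iff ..) (and_congr (hd ex _) (hd ey _))

theorem mem_closure_testToSobolev_of_contDiff {f : ℝ × ℝ → ℂ} (hf : ContDiff ℝ ∞ f) {u : sobolev}
    (h0 : coord 0 u =ᵐ[volume] f) (h1 : coord 1 u =ᵐ[volume] fun p => fderiv ℝ f p ex)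
    (h2 : coord 2 u =ᵐ[volume] fun p => fderiv ℝ f p ey) : u ∈ closure (range testToSobolev) := by
  let φ (n : ℕ) : Test ℂ := ⟨fun p => cutoff n p • f p, (contDiff_cutoff n).smul hf,
    (hasCompactSupport_cutoff n).smul_right, subset_univ _⟩
  have m0 := (memLp_congr_ae h0).1 (Lp.memLp _)
  have m1 := (memLp_congr_ae h1).1 (Lp.memLp _)
  have m2 := (memLp_congr_ae h2).1 (Lp.memLp _)
  refine mem_closure_of_tendsto (b := atTop) ((tendsto_testToSobolev_iff φ u).2 ⟨?_, ?_, ?_⟩)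
    (Eventually.of_forall fun n => mem_range_self (φ n))
  · exact (tendsto_eLpNorm_cutoff_smul_sub two_ne_zero (by simp) m0).congr fun n =>
      eLpNorm_congr_ae (h0.mono fun p hp => congrArg (φ n p - ·) hp.symm)
  · exact (tendsto_eLpNorm_fderiv_cutoff_smul_sub one_le_two (by simp) hf m0 m1).congr fun n =>
      eLpNorm_congr_ae (h1.mono fun p hp => congrArg (fderiv ℝ (φ n) p ex - ·) hp.symm)
  · exact (tendsto_eLpNorm_fderiv_cutoff_smul_sub one_le_two (by simp) hf m0 m2).congr fun n =>
      eLpNorm_congr_ae (h2.mono fun p hp => congrArg (fderiv ℝ (φ n) p ey - ·) hp.symm)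

/-- A sequence of smooth bump functions on the plane that shrink to the origin. -/
def shrinkingBump (n : ℕ) : ContDiffBump (0 : ℝ × ℝ) :=
  ⟨1 / (n + 1) / 2, 1 / (n + 1), by positivity, half_lt_self (by positivity)⟩

/-- The mollification of `f` at the scale `1 / (n + 1)`. -/
def mollify (n : ℕ) (f : L2) : ℝ × ℝ → ℂ :=
  (shrinkingBump n).normed volume ⋆[lsmul ℝ ℝ, volume] f

theorem memLp_mollify (n : ℕ) (f : L2) : MemLp (mollify n f) 2 volume :=
  memLp_convolution (by simp) (ContDiffBump.contDiff_normed _)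
    (ContDiffBump.hasCompactSupport_normed _) (ContDiffBump.nonneg_normed _)
    (ContDiffBump.integral_normed _) f

theorem contDiff_mollify (n : ℕ) (f : L2) : ContDiff ℝ ∞ (mollify n f) :=
  (ContDiffBump.hasCompactSupport_normed _).contDiff_convolution_left _
    (ContDiffBump.contDiff_normed _) ((Lp.memLp f).locallyIntegrable one_le_two)

theorem tendsto_toLp_mollify (f : L2) :
    Tendsto (fun n => (memLp_mollify n f).toLp) atTop (𝓝 f) := by
  rw [Lp.tendsto_Lp_iff_tendsto_eLpNorm']
  refine (tendsto_eLpNorm_convolution_sub (by simp) f (φ := shrinkingBump)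
    (tendsto_one_div_add_atTop_nhds_zero_nat (𝕜 := ℝ))).congr fun n => eLpNorm_congr_ae ?_
  filter_upwards [(memLp_mollify n f).coeFn_toLp] with p hp
  rw [Pi.sub_apply, hp, mollify]

theorem IsWeakDeriv.toLp_mollify_ae_eq {v : ℝ × ℝ} {ψ g : L2} (h : IsWeakDeriv v ψ g) (n : ℕ) :
    (memLp_mollify n g).toLp =ᵐ[volume] fun p => fderiv ℝ (mollify n ψ) p v := by
  filter_upwards [(memLp_mollify n g).coeFn_toLp] with p hp
  rw [hp]
  exact (HasWeakDeriv.fderiv_convolution h ((Lp.memLp ψ).locallyIntegrable one_le_two)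
    (ContDiffBump.contDiff_normed _) (ContDiffBump.hasCompactSupport_normed _) p).symm

theorem denseRange_testToSobolev : DenseRange testToSobolev := by
  intro u
  have hweak (n : ℕ) {v : ℝ × ℝ} {ψ g : L2} (h : IsWeakDeriv v ψ g) :
      IsWeakDeriv v (memLp_mollify n ψ).toLp (memLp_mollify n g).toLp :=
    isWeakDeriv_of_contDiff ((contDiff_mollify n ψ).of_le (by simp))
      (memLp_mollify n ψ).coeFn_toLp (h.toLp_mollify_ae_eq n)
  let w (n : ℕ) : sobolev := ⟨WithLp.toLp 2 fun i => (memLp_mollify n (coord i u)).toLp,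
    mem_sobolev.2 ⟨hweak n (isWeakDeriv_coord_one u), hweak n (isWeakDeriv_coord_two u)⟩⟩
  refine isClosed_closure.mem_of_tendsto (b := atTop) (f := w)
    (tendsto_sobolev_iff.2 fun i => tendsto_toLp_mollify (coord i u))
    (Eventually.of_forall fun n => ?_)
  exact mem_closure_testToSobolev_of_contDiff (contDiff_mollify n (coord 0 u))
    (memLp_mollify n _).coeFn_toLp ((isWeakDeriv_coord_one u).toLp_mollify_ae_eq n)
    ((isWeakDeriv_coord_two u).toLp_mollify_ae_eq n)

end Sobolev

section Multipliers

theorem norm_sq_eq_integral {X E : Type*} [MeasurableSpace X] {μ : Measure X}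
    [NormedAddCommGroup E] {f : Lp E 2 μ} {g : X → E} (h : f =ᵐ[μ] g) :
    ‖f‖ ^ 2 = ∫ x, ‖g x‖ ^ 2 ∂μ := by
  have hg : MemLp g 2 μ := (memLp_congr_ae h).1 (Lp.memLp f)
  rw [Lp.norm_def, eLpNorm_congr_ae h,
    hg.eLpNorm_eq_integral_rpow_norm two_ne_zero ENNReal.ofNat_ne_top,
    ENNReal.toReal_ofReal (by positivity), ← Real.rpow_natCast, ← Real.rpow_mul (by positivity)]
  simp

/-- The density `|∇f|²`. -/
def gradSq {F : Type*} [NormedAddCommGroup F] [NormedSpace ℝ F] (f : ℝ × ℝ → F) (p : ℝ × ℝ) : ℝ :=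
  ‖fderiv ℝ f p ex‖ ^ 2 + ‖fderiv ℝ f p ey‖ ^ 2

theorem gradSq_nonneg {F : Type*} [NormedAddCommGroup F] [NormedSpace ℝ F] (f : ℝ × ℝ → F)
    (p : ℝ × ℝ) : 0 ≤ gradSq f p := by
  unfold gradSq; positivity

theorem integrable_norm_sq (φ : Test ℂ) : Integrable fun p => ‖φ p‖ ^ 2 :=
  (memLp_test volume φ).integrable_norm_pow two_ne_zero

theorem integrable_norm_fderiv_sq (v : ℝ × ℝ) (φ : Test ℂ) :
    Integrable fun p => ‖fderiv ℝ φ p v‖ ^ 2 := by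
  simpa only [lineDerivOp_apply] using integrable_norm_sq (∂_{v} φ)

theorem integrable_gradSq (φ : Test ℂ) : Integrable (gradSq φ) :=
  (integrable_norm_fderiv_sq ex φ).add (integrable_norm_fderiv_sq ey φ)

theorem norm_sq_testToSobolev (φ : Test ℂ) :
    ‖testToSobolev φ‖ ^ 2 = ∫ p, (‖φ p‖ ^ 2 + gradSq φ p) := by
  rw [integral_add (integrable_norm_sq φ) (integrable_gradSq φ), sobolev_norm_sq,
    coord_zero_testToSobolev, coord_one_testToSobolev,
    coord_two_testToSobolev, norm_sq_eq_integral (coeFn_testToLp volume φ),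
    norm_sq_eq_integral (coeFn_testToLp_lineDeriv ex φ),
    norm_sq_eq_integral (coeFn_testToLp_lineDeriv ey φ), add_assoc,
    ← integral_add (integrable_norm_fderiv_sq ex φ) (integrable_norm_fderiv_sq ey φ)]
  rfl

/-- Multiplication by `m` maps `H¹(ℝ²)` into `L²(ℝ²)`. -/
def IsMultiplier (m : ℝ × ℝ → ℝ) : Prop := ∀ ψ ∈ H1, MemLp (fun p => (m p : ℂ) * ψ p) 2 volume

theorem isMultiplier_zero : IsMultiplier fun _ => 0 := fun ψ _ => by simp

namespace IsMultiplier

variable {m : ℝ × ℝ → ℝ} (hm : IsMultiplier m)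

/-- Multiplication by `m`, as a linear map from `H¹(ℝ²)` to `L²(ℝ²)`. -/
def mulLinear : sobolev →ₗ[ℂ] L2 where
  toFun u := (hm _ (coord_zero_mem_H1 u)).toLp _
  map_add' u w := by
    rw [← MemLp.toLp_add]
    refine MemLp.toLp_congr _ _ ?_
    filter_upwards [Lp.coeFn_add (coord 0 u) (coord 0 w)] with p hp
    rw [map_add, hp]
    simp [mul_add]
  map_smul' c u := by
    rw [RingHom.id_apply, ← MemLp.toLp_const_smul]
    refine MemLp.toLp_congr _ _ ?_
    filter_upwards [Lp.coeFn_smul c (coord 0 u)] with p hp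
    rw [map_smul, hp]
    simp only [Pi.smul_apply, smul_eq_mul, mul_left_comm]

theorem coeFn_mulLinear (u : sobolev) :
    hm.mulLinear u =ᵐ[volume] fun p => (m p : ℂ) * coord 0 u p :=
  (hm _ (coord_zero_mem_H1 u)).coeFn_toLp

theorem mulLinear_eq_of_tendsto {u : ℕ → sobolev} {x : sobolev} {y : L2}
    (hu : Tendsto u atTop (𝓝 x)) (hy : Tendsto (hm.mulLinear ∘ u) atTop (𝓝 y)) :
    y = hm.mulLinear x := by
  obtain ⟨ns, hns, hux⟩ := (tendstoInMeasure_of_tendsto_Lp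
    (((coord 0).continuous.tendsto x).comp hu)).exists_seq_tendsto_ae
  obtain ⟨ks, hks, hmy⟩ := (tendstoInMeasure_of_tendsto_Lp
    (hy.comp hns.tendsto_atTop)).exists_seq_tendsto_ae
  have hmul : ∀ᵐ p, ∀ i, hm.mulLinear (u i) p = (m p : ℂ) * coord 0 (u i) p :=
    ae_all_iff.2 fun i => hm.coeFn_mulLinear (u i)
  refine Lp.ext ?_
  filter_upwards [hux, hmy, hmul, hm.coeFn_mulLinear x] with p hux hmy hmul hx
  rw [hx]
  refine tendsto_nhds_unique hmy ?_
  simp only [Function.comp_apply, hmul]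
  exact (hux.comp hks.tendsto_atTop).const_mul _

/-- Multiplication by `m`, as a bounded operator from `H¹(ℝ²)` to `L²(ℝ²)`; it is bounded by the
closed graph theorem. -/
def mulOp : sobolev →L[ℂ] L2 :=
  .ofSeqClosedGraph (g := hm.mulLinear) fun _ _ _ hu hy => hm.mulLinear_eq_of_tendsto hu hy

theorem coeFn_mulOp (u : sobolev) : hm.mulOp u =ᵐ[volume] fun p => (m p : ℂ) * coord 0 u p :=
  hm.coeFn_mulLinear u

theorem coeFn_mulOp_testToSobolev (φ : Test ℂ) :
    hm.mulOp (testToSobolev φ) =ᵐ[volume] fun p => (m p : ℂ) * φ p := by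
  filter_upwards [hm.coeFn_mulOp (testToSobolev φ), coeFn_testToLp volume φ] with p h1 h2
  rw [h1, coord_zero_testToSobolev, h2]

include hm

theorem memLp_mul_test (φ : Test ℂ) : MemLp (fun p => (m p : ℂ) * φ p) 2 volume :=
  (memLp_congr_ae (hm.coeFn_mulOp_testToSobolev φ)).1 (Lp.memLp _)

theorem integrable_mul_test_sq (η : Test ℝ) : Integrable fun p => (m p * η p) ^ 2 := by
  simpa [mul_pow] using (hm.memLp_mul_test (testOfReal η)).integrable_norm_pow two_ne_zero

theorem exists_bound : ∃ C : ℝ, 0 ≤ C ∧ ∀ η : Test ℝ,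
    ∫ p, (m p * η p) ^ 2 ≤ C * ∫ p, (η p ^ 2 + gradSq η p) := by
  refine ⟨‖hm.mulOp‖ ^ 2, sq_nonneg _, fun η => ?_⟩
  have hop := pow_le_pow_left₀ (norm_nonneg _) (hm.mulOp.le_opNorm (testToSobolev (testOfReal η))) 2
  have hderiv (p v : ℝ × ℝ) : fderiv ℝ (testOfReal η) p v = (fderiv ℝ η p v : ℂ) :=
    DFunLike.congr_fun (Complex.ofRealCLM.hasFDerivAt.comp p
      (η.contDiff.differentiable (by simp) p).hasFDerivAt).fderiv v
  rw [mul_pow, norm_sq_testToSobolev, norm_sq_eq_integral (hm.coeFn_mulOp_testToSobolev _)] at hop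
  simpa [gradSq, hderiv, mul_pow] using hop

end IsMultiplier

end Multipliers

section Diamagnetic

variable {E : Type*} [NormedAddCommGroup E] [NormedSpace ℝ E]

/-- The covariant derivative `(i∂_v + m)φ`. -/
def covDeriv (m : E → ℝ) (v : E) (φ : E → ℂ) (p : E) : ℂ :=
  Complex.I * fderiv ℝ φ p v + (m p : ℂ) * φ p

theorem abs_inner_fderiv_le (m : E → ℝ) (v : E) (φ : E → ℂ) (p : E) :
    |inner ℝ (φ p) (fderiv ℝ φ p v)| ≤ ‖φ p‖ * ‖covDeriv m v φ p‖ := by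
  have gauge : inner ℝ (φ p) (fderiv ℝ φ p v) = inner ℝ (φ p) (-Complex.I * covDeriv m v φ p) := by
    simp only [Complex.inner, covDeriv, Complex.mul_re, Complex.mul_im, Complex.add_re,
      Complex.add_im, Complex.I_re, Complex.I_im, Complex.ofReal_re, Complex.ofReal_im,
      Complex.conj_re, Complex.conj_im, Complex.neg_re, Complex.neg_im]
    ring
  rw [gauge]
  exact (abs_real_inner_le_norm _ _).trans (by simp)

theorem fderiv_norm_sq_comp_apply {F : Type*} [NormedAddCommGroup F] [InnerProductSpace ℝ F]
    {f : E → F} {p : E} (h : DifferentiableAt ℝ f p) (v : E) :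
    fderiv ℝ (fun q => ‖f q‖ ^ 2) p v = 2 * inner ℝ (f p) (fderiv ℝ f p v) := by
  rw [h.hasFDerivAt.norm_sq.fderiv]
  simp [two_mul]

theorem abs_fderiv_norm_sq_le (m : E → ℝ) {φ : E → ℂ} {p : E} (h : DifferentiableAt ℝ φ p)
    (v : E) : |fderiv ℝ (fun q => ‖φ q‖ ^ 2) p v| ≤ 2 * (‖φ p‖ * ‖covDeriv m v φ p‖) := by
  rw [fderiv_norm_sq_comp_apply h, abs_mul, abs_two]
  gcongr
  exact abs_inner_fderiv_le m v φ p

/-- The regularised modulus `√(|f|² + ε²)`. -/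
def regNorm {X F : Type*} [Norm F] (ε : ℝ) (f : X → F) (x : X) : ℝ := √(‖f x‖ ^ 2 + ε ^ 2)

section

variable {X F : Type*} [NormedAddCommGroup F] (ε : ℝ) (f : X → F) (x : X)

theorem regNorm_sq : regNorm ε f x ^ 2 = ‖f x‖ ^ 2 + ε ^ 2 := Real.sq_sqrt (by positivity)

theorem norm_le_regNorm : ‖f x‖ ≤ regNorm ε f x :=
  Real.le_sqrt_of_sq_le (le_add_of_nonneg_right (sq_nonneg ε))

theorem le_regNorm : ε ≤ regNorm ε f x :=
  Real.le_sqrt_of_sq_le (le_add_of_nonneg_left (sq_nonneg _))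

theorem regNorm_le (hε : 0 ≤ ε) : regNorm ε f x ≤ ‖f x‖ + ε :=
  Real.sqrt_le_iff.2 ⟨by positivity, by nlinarith [mul_nonneg hε (norm_nonneg (f x))]⟩

end

theorem contDiff_regNorm {F : Type*} [NormedAddCommGroup F] [InnerProductSpace ℝ F] {ε : ℝ}
    (hε : 0 < ε) {f : E → F} {n : WithTop ℕ∞} (h : ContDiff ℝ n f) :
    ContDiff ℝ n (regNorm ε f) :=
  ((h.norm_sq ℝ).add contDiff_const).sqrt fun p => by positivity

theorem norm_fderiv_regNorm_le (m : E → ℝ) {ε : ℝ} (hε : 0 < ε) {φ : E → ℂ} {p : E}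
    (h : DifferentiableAt ℝ φ p) (v : E) :
    ‖fderiv ℝ (regNorm ε φ) p v‖ ≤ ‖covDeriv m v φ p‖ := by
  have hpos : 0 < regNorm ε φ p := hε.trans_le (le_regNorm ε φ p)
  have hd : HasFDerivAt (regNorm ε φ) _ p :=
    (h.hasFDerivAt.norm_sq.add_const (ε ^ 2)).sqrt (by positivity)
  have hval : fderiv ℝ (regNorm ε φ) p v = (regNorm ε φ p)⁻¹ * inner ℝ (φ p) (fderiv ℝ φ p v) := by
    rw [hd.fderiv]
    simp [regNorm]
    ring
  rw [hval, norm_mul, norm_inv, Real.norm_of_nonneg hpos.le, inv_mul_le_iff₀ hpos]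
  exact (abs_inner_fderiv_le m v φ p).trans
    (mul_le_mul_of_nonneg_right (norm_le_regNorm ε φ p) (norm_nonneg _))

/-- The regularised modulus `√(|φ|² + ε²) - ε` of a test function; it vanishes where `φ` does, so
that it is again a test function. -/
def testAbs {ε : ℝ} (hε : 0 < ε) (φ : Test ℂ) : Test ℝ where
  toFun p := regNorm ε φ p - ε
  contDiff' := (contDiff_regNorm hε φ.contDiff).sub contDiff_const
  hasCompactSupport' := φ.hasCompactSupport.comp_left (g := fun z : ℂ => √(‖z‖ ^ 2 + ε ^ 2) - ε)
    (by simp [Real.sqrt_sq hε.le])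
  tsupport_subset' := subset_univ _

theorem testAbs_nonneg {ε : ℝ} (hε : 0 < ε) (φ : Test ℂ) (p : ℝ × ℝ) : 0 ≤ testAbs hε φ p :=
  sub_nonneg.2 (le_regNorm ε φ p)

theorem testAbs_le {ε : ℝ} (hε : 0 < ε) (φ : Test ℂ) (p : ℝ × ℝ) : testAbs hε φ p ≤ ‖φ p‖ :=
  sub_le_iff_le_add.2 (regNorm_le ε φ p hε.le)

theorem tendsto_testAbs (φ : Test ℂ) (p : ℝ × ℝ) :
    Tendsto (fun n : ℕ => testAbs (Nat.one_div_pos_of_nat (n := n)) φ p) atTop (𝓝 ‖φ p‖) := by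
  refine tendsto_of_tendsto_of_tendsto_of_le_of_le (g := fun n : ℕ => ‖φ p‖ - 1 / ((n : ℝ) + 1))
    ?_ tendsto_const_nhds (fun n => sub_le_sub_right (norm_le_regNorm _ φ p) _)
    fun n => testAbs_le _ φ p
  simpa using tendsto_const_nhds.sub (tendsto_one_div_add_atTop_nhds_zero_nat (𝕜 := ℝ))

end Diamagnetic

section MagneticDensity

/-- The density `|(i∇ + A)φ|²`. -/
def magSq (A : ℝ × ℝ → ℝ × ℝ) (φ : ℝ × ℝ → ℂ) (p : ℝ × ℝ) : ℝ :=
  ‖covDeriv (fun q => (A q).1) ex φ p‖ ^ 2 + ‖covDeriv (fun q => (A q).2) ey φ p‖ ^ 2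

theorem magSq_nonneg (A : ℝ × ℝ → ℝ × ℝ) (φ : ℝ × ℝ → ℂ) (p : ℝ × ℝ) : 0 ≤ magSq A φ p := by
  unfold magSq; positivity

theorem gradSq_regNorm_le (A : ℝ × ℝ → ℝ × ℝ) {ε : ℝ} (hε : 0 < ε) {φ : ℝ × ℝ → ℂ} {p : ℝ × ℝ}
    (h : DifferentiableAt ℝ φ p) : gradSq (regNorm ε φ) p ≤ magSq A φ p :=
  add_le_add (pow_le_pow_left₀ (norm_nonneg _) (norm_fderiv_regNorm_le _ hε h ex) 2)
    (pow_le_pow_left₀ (norm_nonneg _) (norm_fderiv_regNorm_le _ hε h ey) 2)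

theorem IsMultiplier.memLp_covDeriv {m : ℝ × ℝ → ℝ} (hm : IsMultiplier m) (v : ℝ × ℝ)
    (φ : Test ℂ) : MemLp (covDeriv m v φ) 2 volume := by
  have hv : MemLp (fun p => fderiv ℝ φ p v) 2 volume := by
    simpa only [← lineDerivOp_apply] using memLp_test volume (∂_{v} φ)
  exact (hv.const_mul Complex.I).add (hm.memLp_mul_test φ)

theorem IsMultiplier.tendsto_integral_mul_testAbs {m : ℝ × ℝ → ℝ} (hm : IsMultiplier m)
    (φ : Test ℂ) :
    Tendsto (fun n : ℕ => ∫ p, (m p * testAbs (Nat.one_div_pos_of_nat (n := n)) φ p) ^ 2) atTop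
      (𝓝 (∫ p, ‖(m p : ℂ) * φ p‖ ^ 2)) := by
  refine tendsto_integral_of_dominated_convergence _
    (fun n => (hm.integrable_mul_test_sq _).aestronglyMeasurable)
    ((hm.memLp_mul_test φ).integrable_norm_pow two_ne_zero)
    (fun n => ae_of_all _ fun p => ?_) (ae_of_all _ fun p => ?_)
  · rw [norm_pow, norm_mul, norm_mul, Complex.norm_real]
    gcongr
    exact (Real.norm_of_nonneg (testAbs_nonneg _ φ p)).trans_le (testAbs_le _ φ p)
  · simpa [mul_pow] using ((tendsto_testAbs φ p).const_mul (m p)).pow 2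

/-- Both components of `A` are multipliers, so that the magnetic form `∫ |i∇ψ + Aψ|²` is defined
on `H¹(ℝ²)`. -/
def IsAdmissible (A : ℝ × ℝ → ℝ × ℝ) : Prop :=
  IsMultiplier (fun p => (A p).1) ∧ IsMultiplier fun p => (A p).2

theorem IsVectorPotential.isAdmissible {B : ℝ × ℝ → ℝ} {A : ℝ × ℝ → ℝ × ℝ}
    (h : IsVectorPotential B A) : IsAdmissible A := ⟨h.memLp_fst, h.memLp_snd⟩

variable {A : ℝ × ℝ → ℝ × ℝ} (hA : IsAdmissible A)

include hA

theorem IsAdmissible.integrable_magSq (φ : Test ℂ) : Integrable (magSq A φ) :=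
  ((hA.1.memLp_covDeriv ex φ).integrable_norm_pow two_ne_zero).add
    ((hA.2.memLp_covDeriv ey φ).integrable_norm_pow two_ne_zero)

theorem IsAdmissible.integral_testAbs_le {ε : ℝ} (hε : 0 < ε) (φ : Test ℂ) :
    ∫ p, (testAbs hε φ p ^ 2 + gradSq (testAbs hε φ) p) ≤ ∫ p, (‖φ p‖ ^ 2 + magSq A φ p) := by
  refine integral_mono_of_nonneg
    (ae_of_all _ fun p => add_nonneg (sq_nonneg _) (gradSq_nonneg _ p))
    ((integrable_norm_sq φ).add (hA.integrable_magSq φ))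
    (ae_of_all _ fun p => add_le_add
      (pow_le_pow_left₀ (testAbs_nonneg hε φ p) (testAbs_le hε φ p) 2) ?_)
  have hgrad : gradSq (testAbs hε φ) p = gradSq (regNorm ε φ) p :=
    congrArg (fun L : ℝ × ℝ →L[ℝ] ℝ => ‖L ex‖ ^ 2 + ‖L ey‖ ^ 2) (fderiv_sub_const ε)
  exact hgrad.trans_le (gradSq_regNorm_le A hε (φ.contDiff.differentiable (by simp) p))

theorem IsMultiplier.exists_magnetic_bound {m : ℝ × ℝ → ℝ} (hm : IsMultiplier m) :
    ∃ C : ℝ, 0 ≤ C ∧ ∀ φ : Test ℂ,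
      ∫ p, ‖(m p : ℂ) * φ p‖ ^ 2 ≤ C * ∫ p, (‖φ p‖ ^ 2 + magSq A φ p) := by
  obtain ⟨C, hC, hb⟩ := hm.exists_bound
  exact ⟨C, hC, fun φ => le_of_tendsto' (hm.tendsto_integral_mul_testAbs φ) fun n =>
    (hb _).trans (mul_le_mul_of_nonneg_left (hA.integral_testAbs_le _ φ) hC)⟩

end MagneticDensity

section Curves

section Line

variable {E F : Type*} [NormedAddCommGroup E] [NormedSpace ℝ E] [NormedAddCommGroup F]
  [NormedSpace ℝ F]

theorem continuous_fderiv_apply_const {f : E → F} (hf : ContDiff ℝ 1 f) (v : E) :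
    Continuous fun p => fderiv ℝ f p v :=
  (hf.continuous_fderiv one_ne_zero).clm_apply continuous_const

theorem integrable_norm_fderiv_apply [MeasurableSpace E] [OpensMeasurableSpace E] {μ : Measure E}
    [IsFiniteMeasureOnCompacts μ] {f : E → F} (hf : ContDiff ℝ 1 f) (hc : HasCompactSupport f)
    (v : E) : Integrable (fun p => ‖fderiv ℝ f p v‖) μ :=
  (continuous_fderiv_apply_const hf v).norm.integrable_of_hasCompactSupport
    (hc.fderiv_apply ℝ v).norm

-- The factor `1/2` comes from integrating the derivative from both ends.
theorem norm_le_half_integral_norm_deriv [CompleteSpace F] {f : ℝ → F} (hf : ContDiff ℝ 1 f)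
    (hc : HasCompactSupport f) (t : ℝ) : ‖f t‖ ≤ (∫ s, ‖deriv f s‖) / 2 := by
  have hright : ‖f t‖ ≤ ∫ s in Ioi t, ‖deriv f s‖ := by
    rw [← norm_neg, ← hc.integral_Ioi_deriv_eq hf t]
    exact norm_integral_le_integral_norm _
  have hleft : ‖f t‖ ≤ ∫ s in Iic t, ‖deriv f s‖ := by
    rw [← hc.integral_Iic_deriv_eq hf t]
    exact norm_integral_le_integral_norm _
  have hi : Integrable fun s => ‖deriv f s‖ :=
    ((hf.continuous_deriv le_rfl).integrable_of_hasCompactSupport hc.deriv).norm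
  have hsplit := intervalIntegral.integral_Iic_add_Ioi (b := t) hi.integrableOn hi.integrableOn
  linarith

theorem hasCompactSupport_line {G : Type*} [Zero G] {f : E → G} (hc : HasCompactSupport f) (p : E)
    {v : E} (hv : v ≠ 0) : HasCompactSupport fun t : ℝ => f (p + t • v) :=
  hc.comp_isClosedEmbedding
    ((Homeomorph.addLeft p).isClosedEmbedding.comp (isClosedEmbedding_smul_left hv))

theorem hasDerivAt_line {f : E → F} (hf : Differentiable ℝ f) (p v : E) (t : ℝ) :
    HasDerivAt (fun t : ℝ => f (p + t • v)) (fderiv ℝ f (p + t • v) v) t := by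
  have h : HasDerivAt (fun t : ℝ => p + t • v) v t := by
    simpa using ((hasDerivAt_id t).smul_const v).const_add p
  exact (hf _).hasFDerivAt.comp_hasDerivAt t h

theorem norm_le_half_integral_line [CompleteSpace F] {f : E → F} (hf : ContDiff ℝ 1 f)
    (hc : HasCompactSupport f) (p : E) {v : E} (hv : v ≠ 0) (t : ℝ) :
    ‖f (p + t • v)‖ ≤ (∫ s : ℝ, ‖fderiv ℝ f (p + s • v) v‖) / 2 := by
  have hline : ContDiff ℝ 1 fun t : ℝ => f (p + t • v) :=
    hf.comp (contDiff_const.add (contDiff_id.smul contDiff_const))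
  simpa only [fun s => (hasDerivAt_line (hf.differentiable one_ne_zero) p v s).deriv] using
    norm_le_half_integral_norm_deriv hline (hasCompactSupport_line hc p hv) t

theorem norm_sub_le_setIntegral {f f' : ℝ → F} [CompleteSpace F]
    (hd : ∀ t, HasDerivAt f (f' t) t) (hc : Continuous f') {a b s t : ℝ} (hs : s ∈ Icc a b)
    (ht : t ∈ Icc a b) : ‖f t - f s‖ ≤ ∫ r in Ioo a b, ‖f' r‖ := by
  rw [← intervalIntegral.integral_eq_sub_of_hasDerivAt (fun r _ => hd r)
    (hc.intervalIntegrable s t), ← integral_Ioc_eq_integral_Ioo]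
  exact intervalIntegral.norm_integral_le_integral_norm_uIoc.trans <|
    setIntegral_mono_set (hc.norm.integrableOn_Icc.mono_set Ioc_subset_Icc_self)
      (ae_of_all _ fun r => norm_nonneg _)
      (Ioc_subset_Ioc (le_min hs.1 ht.1) (max_le hs.2 ht.2)).eventuallyLE

theorem le_average_add_setIntegral {f f' : ℝ → ℝ} (hd : ∀ t, HasDerivAt f (f' t) t)
    (hc : Continuous f') {a b t : ℝ} (hab : a < b) (ht : t ∈ Icc a b) :
    f t ≤ (b - a)⁻¹ * (∫ r in Ioo a b, f r) + ∫ r in Ioo a b, ‖f' r‖ := by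
  have hf : Continuous f := continuous_iff_continuousAt.2 fun t => (hd t).continuousAt
  have hfi : IntegrableOn f (Ioo a b) := hf.integrableOn_Icc.mono_set Ioo_subset_Icc_self
  have hconst (c : ℝ) : IntegrableOn (fun _ : ℝ => c) (Ioo a b) := integrableOn_const (by simp)
  have key : ∫ _ in Ioo a b, f t ≤ ∫ s in Ioo a b, (f s + ∫ r in Ioo a b, ‖f' r‖) := by
    refine setIntegral_mono_on (hconst _) (hfi.add (hconst _)) measurableSet_Ioo fun s hs => ?_
    exact sub_le_iff_le_add'.1 <|
      (le_abs_self _).trans (norm_sub_le_setIntegral hd hc (Ioo_subset_Icc_self hs) ht)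
  rw [integral_add hfi (hconst _), setIntegral_const, setIntegral_const,
    Real.volume_real_Ioo_of_le hab.le, smul_eq_mul, smul_eq_mul] at key
  have hpos : 0 < b - a := sub_pos.2 hab
  rwa [← mul_le_mul_iff_right₀ hpos, mul_add, mul_inv_cancel_left₀ hpos.ne']

end Line

theorem isClosedEmbedding_graph {X Y : Type*} [TopologicalSpace X] [TopologicalSpace Y]
    [T2Space X] [T2Space Y] {γ : X → Y} (hγ : Continuous γ) : IsClosedEmbedding fun x => (x, γ x) :=
  Function.LeftInverse.isClosedEmbedding (f := Prod.fst) (fun _ => rfl) continuous_fst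
    (continuous_id.prodMk hγ)

theorem integrable_graph {F : ℝ × ℝ → ℝ} (hF : Continuous F) (hc : HasCompactSupport F)
    {γ : ℝ → ℝ} (hγ : Continuous γ) : Integrable fun x => F (x, γ x) :=
  (hF.comp (continuous_id.prodMk hγ)).integrable_of_hasCompactSupport
    (hc.comp_isClosedEmbedding (isClosedEmbedding_graph hγ))

theorem integral_graph_le {F : ℝ × ℝ → ℝ} (hF : ContDiff ℝ 1 F) (hc : HasCompactSupport F)
    {γ : ℝ → ℝ} (hγ : Continuous γ) :
    ∫ x, F (x, γ x) ≤ (∫ p, ‖fderiv ℝ F p ey‖) / 2 := by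
  have hi : Integrable fun p => ‖fderiv ℝ F p ey‖ := integrable_norm_fderiv_apply hF hc ey
  rw [Measure.volume_eq_prod, integral_prod _ hi, ← integral_div]
  refine integral_mono (integrable_graph hF.continuous hc hγ) (hi.integral_prod_left.div_const 2)
    fun x => ?_
  have hline := norm_le_half_integral_line hF hc (x, 0) (v := ey) (by simp [ey]) (γ x)
  simp only [ey, Prod.smul_mk, smul_eq_mul, mul_zero, mul_one, Prod.mk_add_mk, add_zero,
    zero_add] at hline
  exact (le_abs_self _).trans hline

theorem setIntegral_antidiagonal {E : Type*} [NormedAddCommGroup E] [NormedSpace ℝ E]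
    {G : ℝ × ℝ → E} (hG : Integrable G) (S : Set ℝ) :
    ∫ p in {p : ℝ × ℝ | p.1 + p.2 ∈ S}, G p = ∫ c in S, ∫ t, G (t, c - t) := by
  have hmp : MeasurePreserving (fun z : ℝ × ℝ => (z.2, z.1 - z.2)) volume volume :=
    measurePreserving_prod_sub_swap volume volume
  have hemb : MeasurableEmbedding fun z : ℝ × ℝ => (z.2, z.1 - z.2) :=
    Continuous.measurableEmbedding (by fun_prop)
      (Function.LeftInverse.injective (g := fun p => (p.1 + p.2, p.1)) fun z => by simp)
  have hpre : (fun z : ℝ × ℝ => (z.2, z.1 - z.2)) ⁻¹' {p : ℝ × ℝ | p.1 + p.2 ∈ S} =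
      S ×ˢ (univ : Set ℝ) := by
    ext z; simp
  rw [← hmp.setIntegral_preimage_emb hemb, hpre, Measure.volume_eq_prod,
    setIntegral_prod (fun z : ℝ × ℝ => G (z.2, z.1 - z.2))
      ((hmp.integrable_comp_emb hemb).2 hG).integrableOn, Measure.restrict_univ]

theorem setIntegral_comp_half {E : Type*} [NormedAddCommGroup E] [NormedSpace ℝ E] {S : Set ℝ}
    (hS : MeasurableSet S) (f : ℝ → E) :
    ∫ c in {c : ℝ | c / 2 ∈ S}, f (c / 2) = (2 : ℝ) • ∫ s in S, f s := by
  have hpre : MeasurableSet {c : ℝ | c / 2 ∈ S} := (measurable_id.div_const 2) hS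
  have hind : {c : ℝ | c / 2 ∈ S}.indicator (fun c => f (c / 2)) =
      fun c => S.indicator f (c / 2) := rfl
  rw [← integral_indicator hpre, ← integral_indicator hS, hind, Measure.integral_comp_div, abs_two]

theorem setIntegral_diagonal_le {F : ℝ × ℝ → ℝ} (hF : ContDiff ℝ 1 F) (hc : HasCompactSupport F)
    {S : Set ℝ} (hS : MeasurableSet S) :
    ∫ s in S, F (s, s) ≤
      (∫ p in {p : ℝ × ℝ | (p.1 + p.2) / 2 ∈ S}, ‖fderiv ℝ F p (ex - ey)‖) / 4 := by
  have hi : Integrable fun p => ‖fderiv ℝ F p (ex - ey)‖ :=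
    integrable_norm_fderiv_apply hF hc (ex - ey)
  have hslices : Integrable fun c => ∫ t, ‖fderiv ℝ F (t, c - t) (ex - ey)‖ :=
    ((measurePreserving_prod_sub_swap volume volume).integrable_comp_of_integrable
      hi).integral_prod_left
  have hdiag : IsClosedEmbedding fun c : ℝ => (c / 2, c / 2) :=
    Function.LeftInverse.isClosedEmbedding (f := fun p : ℝ × ℝ => p.1 + p.2)
      (fun c => add_halves c) (by fun_prop) (by fun_prop)
  have hFdiag : Integrable fun c : ℝ => F (c / 2, c / 2) :=
    (hF.continuous.comp hdiag.continuous).integrable_of_hasCompactSupport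
      (hc.comp_isClosedEmbedding hdiag)
  have hle : ∫ c in {c : ℝ | c / 2 ∈ S}, F (c / 2, c / 2) ≤
      ∫ c in {c : ℝ | c / 2 ∈ S}, (∫ t, ‖fderiv ℝ F (t, c - t) (ex - ey)‖) / 2 := by
    refine setIntegral_mono hFdiag.integrableOn (hslices.div_const 2).integrableOn fun c => ?_
    have hline := norm_le_half_integral_line hF hc (0, c) (v := ex - ey) (by simp [ex, ey]) (c / 2)
    have hpt (t : ℝ) : (0, c) + t • (ex - ey) = (t, c - t) := by
      simp [ex, ey, sub_eq_add_neg]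
    simp only [hpt, sub_half] at hline
    exact (le_abs_self _).trans hline
  rw [setIntegral_comp_half hS fun s => F (s, s), integral_div, smul_eq_mul,
    ← setIntegral_antidiagonal hi {c | c / 2 ∈ S}] at hle
  simp only [mem_ofPred_eq] at hle
  linarith

theorem measurableSet_square (a : ℝ) : MeasurableSet (square a) :=
  measurableSet_Ioo.prod measurableSet_Ioo

theorem integrableOn_square {E : Type*} [NormedAddCommGroup E] {F : ℝ × ℝ → E}
    (hF : Continuous F) (a : ℝ) : IntegrableOn F (square a) :=
  (hF.continuousOn.integrableOn_compact (isCompact_Icc.prod isCompact_Icc)).mono_set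
    (prod_mono (Ioo_subset_Icc_self (a := -a) (b := a)) (Ioo_subset_Icc_self (a := -a) (b := a)))

theorem setIntegral_square {E : Type*} [NormedAddCommGroup E] [NormedSpace ℝ E]
    {F : ℝ × ℝ → E} (hF : Continuous F) (a : ℝ) :
    ∫ p in square a, F p = ∫ x in Ioo (-a) a, ∫ y in Ioo (-a) a, F (x, y) :=
  setIntegral_prod F (integrableOn_square hF a)

theorem integrableOn_slice {E : Type*} [NormedAddCommGroup E] [NormedSpace ℝ E]
    {F : ℝ × ℝ → E} (hF : Continuous F) (a : ℝ) :
    IntegrableOn (fun x => ∫ y in Ioo (-a) a, F (x, y)) (Ioo (-a) a) := by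
  have h := integrableOn_square hF a
  rw [IntegrableOn, Measure.volume_eq_prod, square, ← Measure.prod_restrict] at h
  exact h.integral_prod_left

theorem setIntegral_graph_le {F : ℝ × ℝ → ℝ} (hF : ContDiff ℝ 1 F) {γ : ℝ → ℝ}
    (hγ : Continuous γ) {a : ℝ} (ha : 0 < a) (hγa : ∀ x, |x| < a → |γ x| ≤ a) :
    ∫ x in Ioo (-a) a, F (x, γ x) ≤
      (2 * a)⁻¹ * (∫ p in square a, F p) + ∫ p in square a, ‖fderiv ℝ F p ey‖ := by
  have hd := continuous_fderiv_apply_const hF ey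
  have hslice := (integrableOn_slice hF.continuous a).const_mul (2 * a)⁻¹
  have hslice' := integrableOn_slice hd.norm a
  rw [setIntegral_square hF.continuous, setIntegral_square hd.norm, ← integral_const_mul,
    ← integral_add hslice hslice']
  have hgraph : IntegrableOn (fun x => F (x, γ x)) (Ioo (-a) a) :=
    (hF.continuous.comp (continuous_id.prodMk hγ)).integrableOn_Icc.mono_set Ioo_subset_Icc_self
  refine setIntegral_mono_on hgraph (hslice.add hslice') measurableSet_Ioo fun x hx => ?_
  have hderiv (y : ℝ) : HasDerivAt (fun y => F (x, y)) (fderiv ℝ F (x, y) ey) y := by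
    simpa [ey] using hasDerivAt_line (hF.differentiable one_ne_zero) (x, 0) ey y
  have hbound := le_average_add_setIntegral hderiv (hd.comp (by fun_prop)) (neg_lt_self ha)
    (abs_le.1 (hγa x (abs_lt.2 hx)))
  rwa [sub_neg_eq_add, ← two_mul] at hbound

end Curves

section MagneticCurves

theorem contDiff_norm_sq_test (φ : Test ℂ) : ContDiff ℝ 1 fun p => ‖φ p‖ ^ 2 :=
  (φ.contDiff.of_le (by simp)).norm_sq ℝ

theorem hasCompactSupport_norm_sq_test (φ : Test ℂ) : HasCompactSupport fun p => ‖φ p‖ ^ 2 :=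
  φ.hasCompactSupport.comp_left (g := fun z : ℂ => ‖z‖ ^ 2) (by simp)

theorem integrable_norm_fderiv_norm_sq (φ : Test ℂ) (v : ℝ × ℝ) :
    Integrable fun p => ‖fderiv ℝ (fun q => ‖φ q‖ ^ 2) p v‖ :=
  integrable_norm_fderiv_apply (contDiff_norm_sq_test φ) (hasCompactSupport_norm_sq_test φ) v

theorem integrable_norm_sq_graph {γ : ℝ → ℝ} (hγ : Continuous γ) (φ : Test ℂ) :
    Integrable fun x => ‖φ (x, γ x)‖ ^ 2 :=
  integrable_graph (contDiff_norm_sq_test φ).continuous (hasCompactSupport_norm_sq_test φ) hγ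

theorem IsMultiplier.integral_norm_sq_graph_le {m : ℝ × ℝ → ℝ} (hm : IsMultiplier m) {γ : ℝ → ℝ}
    (hγ : Continuous γ) {ε : ℝ} (hε : 0 < ε) (φ : Test ℂ) :
    ∫ x, ‖φ (x, γ x)‖ ^ 2 ≤
      (ε * (∫ p, ‖φ p‖ ^ 2) + ε⁻¹ * ∫ p, ‖covDeriv m ey φ p‖ ^ 2) / 2 := by
  have hi := (integrable_norm_sq φ).const_mul ε
  have hi' := ((hm.memLp_covDeriv ey φ).integrable_norm_pow two_ne_zero).const_mul ε⁻¹
  refine (integral_graph_le (contDiff_norm_sq_test φ)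
    (hasCompactSupport_norm_sq_test φ) hγ).trans ?_
  rw [← integral_const_mul, ← integral_const_mul, ← integral_add hi hi']
  refine div_le_div_of_nonneg_right
    (integral_mono (integrable_norm_fderiv_norm_sq φ ey) (hi.add hi') fun p => ?_) zero_le_two
  refine (abs_fderiv_norm_sq_le m (φ.contDiff.differentiable (by simp) p) ey).trans ?_
  rw [← mul_assoc]
  exact two_mul_le_add_mul_sq hε

variable {A : ℝ × ℝ → ℝ × ℝ}

theorem norm_fderiv_norm_sq_sub_le {φ : ℝ × ℝ → ℂ} {p : ℝ × ℝ} (h : DifferentiableAt ℝ φ p)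
    {κ : ℝ} (hκ : 0 ≤ κ) : κ / 2 * ‖fderiv ℝ (fun q => ‖φ q‖ ^ 2) p (ex - ey)‖ ≤
      magSq A φ p + κ ^ 2 / 2 * ‖φ p‖ ^ 2 := by
  set d := ‖covDeriv (fun q => (A q).1) ex φ p‖ with hd
  set e := ‖covDeriv (fun q => (A q).2) ey φ p‖ with he
  have hxy : ‖fderiv ℝ (fun q => ‖φ q‖ ^ 2) p (ex - ey)‖ ≤ 2 * (‖φ p‖ * d) + 2 * (‖φ p‖ * e) := by
    rw [map_sub]
    exact (norm_sub_le _ _).trans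
      (add_le_add (abs_fderiv_norm_sq_le _ h ex) (abs_fderiv_norm_sq_le _ h ey))
  rw [magSq, ← hd, ← he]
  nlinarith [mul_le_mul_of_nonneg_left hxy hκ, sq_nonneg (d - κ / 2 * ‖φ p‖),
    sq_nonneg (e - κ / 2 * ‖φ p‖)]

variable (hA : IsAdmissible A)

include hA

theorem IsAdmissible.setIntegral_norm_sq_diagonal_le {κ : ℝ} (hκ : 0 ≤ κ) {S : Set ℝ}
    (hS : MeasurableSet S) (φ : Test ℂ) :
    2 * κ * ∫ s in S, ‖φ (s, s)‖ ^ 2 ≤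
      ∫ p in {p : ℝ × ℝ | (p.1 + p.2) / 2 ∈ S}, (magSq A φ p + κ ^ 2 / 2 * ‖φ p‖ ^ 2) := by
  have hle := setIntegral_diagonal_le (contDiff_norm_sq_test φ)
    (hasCompactSupport_norm_sq_test φ) hS
  calc 2 * κ * ∫ s in S, ‖φ (s, s)‖ ^ 2
      ≤ ∫ p in {p : ℝ × ℝ | (p.1 + p.2) / 2 ∈ S},
          κ / 2 * ‖fderiv ℝ (fun q => ‖φ q‖ ^ 2) p (ex - ey)‖ := by
        rw [integral_const_mul]
        nlinarith [mul_le_mul_of_nonneg_left hle hκ]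
    _ ≤ _ := setIntegral_mono
        ((integrable_norm_fderiv_norm_sq φ _).const_mul _).integrableOn
        ((hA.integrable_magSq φ).add ((integrable_norm_sq φ).const_mul _)).integrableOn
        fun p => norm_fderiv_norm_sq_sub_le (φ.contDiff.differentiable (by simp) p) hκ

theorem IsAdmissible.setIntegral_norm_sq_graph_le {γ : ℝ → ℝ} (hγ : Continuous γ) {a : ℝ}
    (ha : 0 < a) (hγa : ∀ x, |x| < a → |γ x| ≤ a) (φ : Test ℂ) :
    ∫ x in Ioo (-a) a, ‖φ (x, γ x)‖ ^ 2 ≤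
      ((2 * a)⁻¹ + 1) * (∫ p in square a, ‖φ p‖ ^ 2) + ∫ p in square a, magSq A φ p := by
  have hi := (integrable_norm_sq φ).integrableOn (s := square a)
  have hi' := (hA.integrable_magSq φ).integrableOn (s := square a)
  have hderiv : ∫ p in square a, ‖fderiv ℝ (fun q => ‖φ q‖ ^ 2) p ey‖ ≤
      ∫ p in square a, (‖φ p‖ ^ 2 + magSq A φ p) := by
    refine setIntegral_mono (integrable_norm_fderiv_norm_sq φ ey).integrableOn (hi.add hi')
      fun p => (abs_fderiv_norm_sq_le (fun q => (A q).2)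
        (φ.contDiff.differentiable (by simp) p) ey).trans ?_
    rw [← mul_assoc]
    exact (two_mul_le_add_sq _ _).trans
      (add_le_add_right (le_add_of_nonneg_left (sq_nonneg _)) _)
  rw [integral_add hi hi'] at hderiv
  linarith [setIntegral_graph_le (contDiff_norm_sq_test φ) hγ ha hγa]

end MagneticCurves

section ArcLength

/-- The density `√(1 + γ'²)` of the arc length of the graph of `γ`. -/
def speed (γ : ℝ → ℝ) (x : ℝ) : ℝ := √(1 + deriv γ x ^ 2)

theorem speed_nonneg (γ : ℝ → ℝ) (x : ℝ) : 0 ≤ speed γ x := Real.sqrt_nonneg _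

theorem measurable_speed (γ : ℝ → ℝ) : Measurable (speed γ) :=
  (((measurable_deriv γ).pow_const 2).const_add 1).sqrt

/-- `γ` is continuous and the arc length density of its graph is almost everywhere at most `W`. -/
structure HasSpeedLE (γ : ℝ → ℝ) (W : ℝ) : Prop where
  continuous : Continuous γ
  speed_le : ∀ᵐ x, speed γ x ≤ W

theorem integral_arcLength {γ : ℝ → ℝ} (hγ : Continuous γ) {E : Type*} [NormedAddCommGroup E]
    [NormedSpace ℝ E] [SecondCountableTopologyEither (ℝ × ℝ) E] {F : ℝ × ℝ → E}
    (hF : Continuous F) : ∫ p, F p ∂(arcLength γ) = ∫ x, speed γ x • F (x, γ x) := by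
  have hgraph : Measurable fun x => (x, γ x) := measurable_id.prodMk hγ.measurable
  change ∫ p, F p ∂(volume.withDensity fun x => ENNReal.ofReal (speed γ x)).map _ = _
  rw [integral_map hgraph.aemeasurable hF.aestronglyMeasurable,
    integral_withDensity_eq_integral_toReal_smul (measurable_speed γ).ennreal_ofReal
      (ae_of_all _ fun _ => ENNReal.ofReal_lt_top)]
  simp only [ENNReal.toReal_ofReal (speed_nonneg γ _)]

theorem norm_sq_testToLp_arcLength {γ : ℝ → ℝ} (hγ : Continuous γ)
    [IsFiniteMeasureOnCompacts (arcLength γ)] (φ : Test ℂ) :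
    ‖testToLp (arcLength γ) φ‖ ^ 2 = ∫ x, speed γ x * ‖φ (x, γ x)‖ ^ 2 := by
  rw [norm_sq_eq_integral (coeFn_testToLp _ φ)]
  exact integral_arcLength hγ (contDiff_norm_sq_test φ).continuous

namespace HasSpeedLE

variable {γ : ℝ → ℝ} {W : ℝ} (h : HasSpeedLE γ W)

include h

theorem one_le : 1 ≤ W := by
  obtain ⟨x, hx⟩ := h.speed_le.exists
  exact (Real.one_le_sqrt.2 (le_add_of_nonneg_right (sq_nonneg _))).trans hx

theorem nonneg : 0 ≤ W := zero_le_one.trans h.one_le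

theorem isFiniteMeasureOnCompacts_arcLength : IsFiniteMeasureOnCompacts (arcLength γ) := by
  refine ⟨fun K hK => ?_⟩
  have hgraph : Measurable fun x => (x, γ x) := measurable_id.prodMk h.continuous.measurable
  have hpre : IsCompact ((fun x => (x, γ x)) ⁻¹' K) :=
    (isClosedEmbedding_graph h.continuous).isCompact_preimage hK
  rw [arcLength, Measure.map_apply hgraph hK.measurableSet,
    withDensity_apply _ (hgraph hK.measurableSet)]
  calc ∫⁻ x in (fun x => (x, γ x)) ⁻¹' K, ENNReal.ofReal (speed γ x)
      ≤ ∫⁻ _ in (fun x => (x, γ x)) ⁻¹' K, ENNReal.ofReal W :=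
        lintegral_mono_ae
          ((ae_restrict_of_ae h.speed_le).mono fun x hx => ENNReal.ofReal_le_ofReal hx)
    _ < ⊤ := by
        rw [setLIntegral_const]
        exact ENNReal.mul_lt_top ENNReal.ofReal_lt_top hpre.measure_lt_top

theorem integrable_speed_mul (φ : Test ℂ) :
    Integrable fun x => speed γ x * ‖φ (x, γ x)‖ ^ 2 := by
  refine (integrable_norm_sq_graph h.continuous φ).bdd_mul (c := W)
    (measurable_speed γ).aestronglyMeasurable ?_
  filter_upwards [h.speed_le] with x hx
  rwa [Real.norm_of_nonneg (speed_nonneg γ x)]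

theorem setIntegral_speed_mul_le (φ : Test ℂ) (S : Set ℝ) :
    ∫ x in S, speed γ x * ‖φ (x, γ x)‖ ^ 2 ≤ W * ∫ x in S, ‖φ (x, γ x)‖ ^ 2 := by
  rw [← integral_const_mul]
  refine setIntegral_mono_ae (h.integrable_speed_mul φ).integrableOn
    ((integrable_norm_sq_graph h.continuous φ).const_mul W).integrableOn ?_
  filter_upwards [h.speed_le] with x hx
  exact mul_le_mul_of_nonneg_right hx (sq_nonneg _)

variable [IsFiniteMeasureOnCompacts (arcLength γ)]

theorem norm_sq_testToLp_le {m : ℝ × ℝ → ℝ} (hm : IsMultiplier m) {ε : ℝ} (hε : 0 < ε)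
    (φ : Test ℂ) : ‖testToLp (arcLength γ) φ‖ ^ 2 ≤
      W * ((ε * (∫ p, ‖φ p‖ ^ 2) + ε⁻¹ * ∫ p, ‖covDeriv m ey φ p‖ ^ 2) / 2) := by
  rw [norm_sq_testToLp_arcLength h.continuous]
  refine le_trans ?_
    (mul_le_mul_of_nonneg_left (hm.integral_norm_sq_graph_le h.continuous hε φ) h.nonneg)
  simpa only [Measure.restrict_univ] using h.setIntegral_speed_mul_le φ univ

theorem norm_testToLp_le (φ : Test ℂ) :
    ‖testToLp (arcLength γ) φ‖ ≤ √W * ‖testToSobolev φ‖ := by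
  refine le_of_sq_le_sq ?_ (by positivity)
  rw [mul_pow, Real.sq_sqrt h.nonneg, norm_sq_testToSobolev]
  refine (h.norm_sq_testToLp_le isMultiplier_zero one_pos φ).trans
    (mul_le_mul_of_nonneg_left ?_ h.nonneg)
  have hcov (p : ℝ × ℝ) : ‖covDeriv (fun _ => 0) ey φ p‖ = ‖fderiv ℝ φ p ey‖ := by simp [covDeriv]
  have hgrad : ∫ p, ‖fderiv ℝ φ p ey‖ ^ 2 ≤ ∫ p, gradSq φ p :=
    integral_mono (integrable_norm_fderiv_sq ey φ) (integrable_gradSq φ)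
      fun p => le_add_of_nonneg_left (sq_nonneg _)
  have hφ : 0 ≤ ∫ p, ‖φ p‖ ^ 2 := integral_nonneg fun p => sq_nonneg _
  have hgrad' : 0 ≤ ∫ p, gradSq φ p := integral_nonneg (gradSq_nonneg φ)
  simp only [hcov, integral_add (integrable_norm_sq φ) (integrable_gradSq φ)]
  linarith

end HasSpeedLE

/-- The trace on the graph of `γ`, as a bounded operator on `H¹(ℝ²)`. -/
def traceOp (γ : ℝ → ℝ) [IsFiniteMeasureOnCompacts (arcLength γ)] :
    sobolev →L[ℂ] Lp ℂ 2 (arcLength γ) :=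
  (testToLp (arcLength γ)).extendOfNorm testToSobolev

namespace HasSpeedLE

variable {γ : ℝ → ℝ} {W : ℝ} (h : HasSpeedLE γ W) [IsFiniteMeasureOnCompacts (arcLength γ)]

include h

theorem traceOp_testToSobolev (φ : Test ℂ) :
    traceOp γ (testToSobolev φ) = testToLp (arcLength γ) φ :=
  LinearMap.extendOfNorm_eq denseRange_testToSobolev ⟨√W, h.norm_testToLp_le⟩ φ

theorem isTrace_iff (u : sobolev) (τ : Lp ℂ 2 (arcLength γ)) :
    IsTrace γ (coord 0 u) τ ↔ τ = traceOp γ u := by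
  have htrace {φ : ℕ → Test ℂ} (hφ : Tendsto (fun n => testToSobolev (φ n)) atTop (𝓝 u)) :
      Tendsto (fun n => testToLp (arcLength γ) (φ n)) atTop (𝓝 (traceOp γ u)) := by
    simpa only [Function.comp_def, h.traceOp_testToSobolev] using
      ((traceOp γ).continuous.tendsto u).comp hφ
  simp only [IsTrace, weakDeriv_ex_coord, weakDeriv_ey_coord]
  constructor
  · rintro ⟨φ, hφ, h0, h1, h2, hτ⟩
    let χ (n : ℕ) : Test ℂ := ⟨φ n, (hφ n).1, (hφ n).2, subset_univ _⟩
    exact tendsto_nhds_unique ((tendsto_testToLp_iff (arcLength γ) χ τ).2 hτ)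
      (htrace ((tendsto_testToSobolev_iff χ u).2 ⟨h0, h1, h2⟩))
  · rintro rfl
    obtain ⟨w, hw, hlim⟩ := mem_closure_iff_seq_limit.1 (denseRange_testToSobolev u)
    choose χ hχ using hw
    obtain rfl : w = fun n => testToSobolev (χ n) := (funext hχ).symm
    obtain ⟨h0, h1, h2⟩ := (tendsto_testToSobolev_iff χ u).1 hlim
    exact ⟨fun n => χ n, fun n => ⟨(χ n).contDiff, (χ n).hasCompactSupport⟩, h0, h1, h2,
      (tendsto_testToLp_iff (arcLength γ) χ _).1 (htrace hlim)⟩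

theorem trace_coord (u : sobolev) : trace γ (coord 0 u) = traceOp γ u := by
  have hex : ∃ τ, IsTrace γ (coord 0 u) τ := ⟨_, (h.isTrace_iff u _).2 rfl⟩
  rw [trace, dif_pos hex]
  exact (h.isTrace_iff u _).1 hex.choose_spec

end HasSpeedLE

end ArcLength

section Poincare

theorem sq_setIntegral_norm_le {F : Type*} [NormedAddCommGroup F] {f : ℝ → F} (hf : Continuous f)
    {a b : ℝ} (hab : a < b) :
    (∫ r in Ioo a b, ‖f r‖) ^ 2 ≤ (b - a) * ∫ r in Ioo a b, ‖f r‖ ^ 2 := by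
  have hpos : 0 < b - a := sub_pos.2 hab
  have jensen : (⨍ r in Ioo a b, ‖f r‖) ^ 2 ≤ ⨍ r in Ioo a b, ‖f r‖ ^ 2 :=
    (even_two.convexOn_pow (𝕜 := ℝ)).map_set_average_le (by fun_prop) isClosed_univ
      (by simp [hab]) (by simp) (by simp)
      (hf.norm.integrableOn_Icc.mono_set Ioo_subset_Icc_self)
      ((hf.norm.pow 2).integrableOn_Icc.mono_set Ioo_subset_Icc_self)
  rw [setAverage_eq, setAverage_eq, Real.volume_real_Ioo_of_le hab.le, smul_eq_mul, smul_eq_mul,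
    mul_pow] at jensen
  have hscaled := mul_le_mul_of_nonneg_left jensen (sq_nonneg (b - a))
  rwa [← mul_assoc, ← mul_assoc, inv_pow, mul_inv_cancel₀ (pow_pos hpos 2).ne', one_mul, sq (b - a),
    mul_inv_cancel_right₀ hpos.ne'] at hscaled

theorem norm_sub_sq_le_setIntegral {F : Type*} [NormedAddCommGroup F] [NormedSpace ℝ F]
    [CompleteSpace F] {f f' : ℝ → F} (hd : ∀ t, HasDerivAt f (f' t) t) (hc : Continuous f')
    {a b s t : ℝ} (hab : a < b) (hs : s ∈ Icc a b) (ht : t ∈ Icc a b) :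
    ‖f t - f s‖ ^ 2 ≤ (b - a) * ∫ r in Ioo a b, ‖f' r‖ ^ 2 :=
  (pow_le_pow_left₀ (norm_nonneg _) (norm_sub_le_setIntegral hd hc hs ht) 2).trans
    (sq_setIntegral_norm_le hc hab)

theorem exists_slice_le_setIntegral_square {F : ℝ × ℝ → ℝ} (hF : Continuous F) {a : ℝ}
    (ha : 0 < a) :
    ∃ y ∈ Ioo (-a) a, 2 * a * ∫ x in Ioo (-a) a, F (x, y) ≤ ∫ p in square a, F p := by
  have hswap : Continuous fun q : ℝ × ℝ => F q.swap := hF.comp continuous_swap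
  obtain ⟨y, hy, hle⟩ :=
    exists_le_setAverage (by simp [ha]) (by simp) (integrableOn_slice hswap a)
  have hfubini : ∫ y in Ioo (-a) a, ∫ x in Ioo (-a) a, F (x, y) = ∫ p in square a, F p :=
    (setIntegral_square hswap a).symm.trans (setIntegral_prod_swap _ _ F)
  rw [setAverage_eq, Real.volume_real_Ioo_of_le (by linarith)] at hle
  simp only [Prod.swap_prod_mk, hfubini, smul_eq_mul, sub_neg_eq_add, ← two_mul] at hle
  exact ⟨y, hy, (le_inv_mul_iff₀ (by positivity)).1 hle⟩

theorem sq_sub_le_setIntegral_add_setIntegral {w : ℝ × ℝ → ℝ} (hw : ContDiff ℝ 1 w) {a : ℝ}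
    {x x₀ y y₀ : ℝ} (hx : x ∈ Ioo (-a) a) (hx₀ : x₀ ∈ Ioo (-a) a) (hy : y ∈ Ioo (-a) a)
    (hy₀ : y₀ ∈ Ioo (-a) a) :
    (w (x, y) - w (x₀, y₀)) ^ 2 ≤
      4 * a * ((∫ t in Ioo (-a) a, ‖fderiv ℝ w (x, t) ey‖ ^ 2) +
        ∫ t in Ioo (-a) a, ‖fderiv ℝ w (t, y₀) ex‖ ^ 2) := by
  have hd := hw.differentiable one_ne_zero
  have hdx (t : ℝ) : HasDerivAt (fun t => w (t, y₀)) (fderiv ℝ w (t, y₀) ex) t := by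
    simpa [ex] using hasDerivAt_line hd (0, y₀) ex t
  have hdy (t : ℝ) : HasDerivAt (fun t => w (x, t)) (fderiv ℝ w (x, t) ey) t := by
    simpa [ey] using hasDerivAt_line hd (x, 0) ey t
  have hvert := norm_sub_sq_le_setIntegral hdy
    ((continuous_fderiv_apply_const hw ey).comp (by fun_prop)) (hx.1.trans hx.2)
    (Ioo_subset_Icc_self hy₀) (Ioo_subset_Icc_self hy)
  have hhor := norm_sub_sq_le_setIntegral hdx
    ((continuous_fderiv_apply_const hw ex).comp (by fun_prop)) (hx.1.trans hx.2)
    (Ioo_subset_Icc_self hx₀) (Ioo_subset_Icc_self hx)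
  rw [Real.norm_eq_abs, sq_abs] at hvert hhor
  have := add_sq_le (a := w (x, y) - w (x, y₀)) (b := w (x, y₀) - w (x₀, y₀))
  rw [sub_add_sub_cancel] at this
  linarith

theorem volume_real_square {a : ℝ} (ha : 0 ≤ a) : volume.real (square a) = (2 * a) ^ 2 := by
  rw [Measure.volume_eq_prod, square, measureReal_prod_prod,
    Real.volume_real_Ioo_of_le (by linarith)]
  ring

theorem continuous_gradSq {F : Type*} [NormedAddCommGroup F] [NormedSpace ℝ F] {f : ℝ × ℝ → F}
    (hf : ContDiff ℝ 1 f) : Continuous (gradSq f) :=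
  ((continuous_fderiv_apply_const hf ex).norm.pow 2).add
    ((continuous_fderiv_apply_const hf ey).norm.pow 2)

theorem exists_setIntegral_sq_sub_le {w : ℝ × ℝ → ℝ} (hw : ContDiff ℝ 1 w) {a : ℝ} (ha : 0 < a) :
    ∃ c : ℝ, ∫ p in square a, (w p - c) ^ 2 ≤ 8 * a ^ 2 * ∫ p in square a, gradSq w p := by
  have hx : Continuous fun p => ‖fderiv ℝ w p ex‖ ^ 2 :=
    (continuous_fderiv_apply_const hw ex).norm.pow 2
  have hy : Continuous fun p => ‖fderiv ℝ w p ey‖ ^ 2 :=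
    (continuous_fderiv_apply_const hw ey).norm.pow 2
  obtain ⟨y₀, hy₀, hslice⟩ := exists_slice_le_setIntegral_square hx ha
  have hvol : volume.real (Ioo (-a) a) = 2 * a := by
    rw [Real.volume_real_Ioo_of_le (by linarith)]; ring
  set g := ∫ t in Ioo (-a) a, ‖fderiv ℝ w (t, y₀) ex‖ ^ 2
  have hconst (c : ℝ) : IntegrableOn (fun _ : ℝ => c) (Ioo (-a) a) := integrableOn_const (by simp)
  have hw0 : Continuous fun p => (w p - w (0, y₀)) ^ 2 := (hw.continuous.sub continuous_const).pow 2
  refine ⟨w (0, y₀), ?_⟩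
  calc ∫ p in square a, (w p - w (0, y₀)) ^ 2
      = ∫ x in Ioo (-a) a, ∫ y in Ioo (-a) a, (w (x, y) - w (0, y₀)) ^ 2 := setIntegral_square hw0 a
    _ ≤ ∫ x in Ioo (-a) a,
          2 * a * (4 * a * ((∫ t in Ioo (-a) a, ‖fderiv ℝ w (x, t) ey‖ ^ 2) + g)) := by
        refine setIntegral_mono_on (integrableOn_slice hw0 a)
          ((((integrableOn_slice hy a).add (hconst g)).const_mul _).const_mul _)
          measurableSet_Ioo fun x hx => ?_
        have hx0 := hw0.comp (Continuous.prodMk_right x)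
        refine (setIntegral_mono_on (hx0.integrableOn_Icc.mono_set Ioo_subset_Icc_self) (hconst _)
          measurableSet_Ioo fun y hy =>
            sq_sub_le_setIntegral_add_setIntegral hw hx ⟨neg_neg_of_pos ha, ha⟩ hy hy₀).trans_eq ?_
        rw [setIntegral_const, hvol, smul_eq_mul]
    _ = 8 * a ^ 2 * (2 * a * g + ∫ p in square a, ‖fderiv ℝ w p ey‖ ^ 2) := by
        rw [integral_const_mul, integral_const_mul,
          integral_add (integrableOn_slice hy a) (hconst g), setIntegral_const, hvol,
          setIntegral_square hy, smul_eq_mul]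
        ring
    _ ≤ 8 * a ^ 2 * ∫ p in square a, gradSq w p := by
        simp only [gradSq]
        rw [integral_add (integrableOn_square hx a) (integrableOn_square hy a)]
        gcongr

end Poincare

section LocalMultipliers

/-- The product of a test function with a smooth function. -/
def testMul (χ : Test ℝ) {f : ℝ × ℝ → ℝ} (hf : ContDiff ℝ ∞ f) : Test ℝ where
  toFun p := χ p * f p
  contDiff' := χ.contDiff.mul hf
  hasCompactSupport' := χ.hasCompactSupport.mul_right
  tsupport_subset' := subset_univ _

theorem exists_bound_test (χ : Test ℝ) :
    ∃ M : ℝ, 0 ≤ M ∧ ∀ p, |χ p| ≤ M ∧ |fderiv ℝ χ p ex| ≤ M ∧ |fderiv ℝ χ p ey| ≤ M := by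
  obtain ⟨M₀, h₀⟩ := χ.contDiff.continuous.bounded_above_of_compact_support χ.hasCompactSupport
  have hderiv (v : ℝ × ℝ) : ∃ M, ∀ p, ‖fderiv ℝ χ p v‖ ≤ M :=
    (contDiff_fderiv_apply χ.contDiff v).continuous.bounded_above_of_compact_support
      (χ.hasCompactSupport.fderiv_apply ℝ v)
  obtain ⟨M₁, h₁⟩ := hderiv ex
  obtain ⟨M₂, h₂⟩ := hderiv ey
  exact ⟨max M₀ (max M₁ M₂), le_max_of_le_left ((norm_nonneg _).trans (h₀ 0)), fun p =>
    ⟨le_max_of_le_left (h₀ p), le_max_of_le_right (le_max_of_le_left (h₁ p)),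
      le_max_of_le_right (le_max_of_le_right (h₂ p))⟩⟩

theorem fderiv_mul_apply {E : Type*} [NormedAddCommGroup E] [NormedSpace ℝ E] {f g : E → ℝ} {p : E}
    (hf : DifferentiableAt ℝ f p) (hg : DifferentiableAt ℝ g p) (v : E) :
    fderiv ℝ (fun p => f p * g p) p v = f p * fderiv ℝ g p v + g p * fderiv ℝ f p v := by
  rw [fderiv_fun_mul hf hg]
  rfl

theorem sq_fderiv_mul_le {E : Type*} [NormedAddCommGroup E] [NormedSpace ℝ E] {η f : E → ℝ} {p : E}
    (hη : DifferentiableAt ℝ η p) (hf : DifferentiableAt ℝ f p) (v : E) {M : ℝ} (h₀ : |η p| ≤ M)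
    (h₁ : |fderiv ℝ η p v| ≤ M) :
    ‖fderiv ℝ (fun p => η p * f p) p v‖ ^ 2 ≤ 2 * M ^ 2 * (f p ^ 2 + ‖fderiv ℝ f p v‖ ^ 2) := by
  have i₀ := mul_le_mul_of_nonneg_right (sq_le_sq.2 (h₀.trans (le_abs_self M)))
    (sq_nonneg (fderiv ℝ f p v))
  have i₁ := mul_le_mul_of_nonneg_right (sq_le_sq.2 (h₁.trans (le_abs_self M))) (sq_nonneg (f p))
  simp only [Real.norm_eq_abs, sq_abs]
  rw [fderiv_mul_apply hη hf]
  refine add_sq_le.trans ?_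
  rw [mul_pow, mul_pow]
  linarith

/-- The Sobolev energy of a function on the square. -/
def squareEnergy (a : ℝ) (f : ℝ × ℝ → ℝ) : ℝ := ∫ p in square a, (f p ^ 2 + gradSq f p)

theorem squareEnergy_eq {f : ℝ × ℝ → ℝ} (hf : ContDiff ℝ 1 f) (a : ℝ) :
    squareEnergy a f = (∫ p in square a, f p ^ 2) + ∫ p in square a, gradSq f p :=
  integral_add (integrableOn_square (hf.continuous.pow 2) a)
    (integrableOn_square (continuous_gradSq hf) a)

theorem integral_eq_squareEnergy {a : ℝ} {η : ℝ × ℝ → ℝ} (h : tsupport η ⊆ square a) :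
    ∫ p, (η p ^ 2 + gradSq η p) = squareEnergy a η := by
  refine (setIntegral_eq_integral_of_forall_compl_eq_zero fun p hp => ?_).symm
  rw [gradSq, image_eq_zero_of_notMem_tsupport (mt (@h p) hp),
    fderiv_of_notMem_tsupport ℝ (mt (@h p) hp)]
  simp

theorem exists_squareEnergy_mul_le (χ : Test ℝ) : ∃ C : ℝ, 0 ≤ C ∧ ∀ (a : ℝ) (f : ℝ × ℝ → ℝ),
    ContDiff ℝ 1 f → squareEnergy a (fun p => χ p * f p) ≤ C * squareEnergy a f := by
  obtain ⟨M, -, hM⟩ := exists_bound_test χ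
  refine ⟨5 * M ^ 2, by positivity, fun a f hf => ?_⟩
  have hχ : ContDiff ℝ 1 χ := χ.contDiff.of_le (by simp)
  have hcont {g : ℝ × ℝ → ℝ} (hg : ContDiff ℝ 1 g) : Continuous fun p => g p ^ 2 + gradSq g p :=
    (hg.continuous.pow 2).add (continuous_gradSq hg)
  rw [squareEnergy, squareEnergy, ← integral_const_mul]
  refine setIntegral_mono (integrableOn_square (hcont (hχ.mul hf)) a)
    ((integrableOn_square (hcont hf) a).const_mul _) fun p => ?_
  obtain ⟨h₀, hx, hy⟩ := hM p
  have dχ := hχ.differentiable one_ne_zero p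
  have df := hf.differentiable one_ne_zero p
  have kx := sq_fderiv_mul_le dχ df ex h₀ hx
  have ky := sq_fderiv_mul_le dχ df ey h₀ hy
  have k₀ := mul_le_mul_of_nonneg_right (sq_le_sq.2 (h₀.trans (le_abs_self M))) (sq_nonneg (f p))
  have hgrad := mul_nonneg (sq_nonneg M) (gradSq_nonneg f p)
  simp only [gradSq] at hgrad ⊢
  rw [mul_pow]
  linarith

theorem IsMultiplier.exists_local_bound {m : ℝ × ℝ → ℝ} (hm : IsMultiplier m) {a : ℝ}
    {χ : Test ℝ} (hχ : tsupport χ ⊆ square a) :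
    ∃ C : ℝ, 0 ≤ C ∧ ∀ f : ℝ × ℝ → ℝ, ContDiff ℝ ∞ f →
      ∫ p, (m p * (χ p * f p)) ^ 2 ≤ C * squareEnergy a f := by
  obtain ⟨C, hC, hmul⟩ := hm.exists_bound
  obtain ⟨D, hD, hprod⟩ := exists_squareEnergy_mul_le χ
  refine ⟨C * D, mul_nonneg hC hD, fun f hf => (hmul (testMul χ hf)).trans ?_⟩
  have hsupp : tsupport (testMul χ hf) ⊆ square a := tsupport_mul_subset_left.trans hχ
  rw [mul_assoc, integral_eq_squareEnergy hsupp]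
  exact mul_le_mul_of_nonneg_left (hprod a f (hf.of_le (by simp))) hC

end LocalMultipliers

section FieldBounds

variable {a : ℝ} {χ : Test ℝ}

theorem IsMultiplier.integrable_mul_test {m : ℝ × ℝ → ℝ} (hm : IsMultiplier m) (η : Test ℝ) :
    Integrable fun p => m p * η p := by
  have hL2 : MemLp (fun p => m p * η p) 2 volume := by
    simpa [← Complex.ofReal_mul] using (hm.memLp_mul_test (testOfReal η)).re
  refine memLp_one_iff_integrable.1 <|
    hL2.mono_exponent_of_measure_support_ne_top (s := tsupport η) (fun p hp => ?_)
      η.hasCompactSupport.measure_lt_top.ne one_le_two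
  rw [image_eq_zero_of_notMem_tsupport hp, mul_zero]

/-- The density controlling `m ∂_v(χ f g)` in terms of each of the factors `f` and `g`. -/
def productDensity (m : ℝ × ℝ → ℝ) (χ : ℝ × ℝ → ℝ) (v : ℝ × ℝ) (f : ℝ × ℝ → ℝ) (p : ℝ × ℝ) : ℝ :=
  (m p * (fderiv ℝ χ p v * f p)) ^ 2 + (m p * (χ p * f p)) ^ 2 + (f p ^ 2 + gradSq f p)

theorem abs_mul_fderiv_mul_mul_le (m : ℝ × ℝ → ℝ) {χ f g : ℝ × ℝ → ℝ} {p v : ℝ × ℝ}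
    (hχ : DifferentiableAt ℝ χ p) (hf : DifferentiableAt ℝ f p) (hg : DifferentiableAt ℝ g p)
    (hv : v = ex ∨ v = ey) {δ : ℝ} (hδ : 0 < δ) :
    |m p * fderiv ℝ (fun q => χ q * (f q * g q)) p v| ≤
      δ * productDensity m χ v f p + δ⁻¹ * productDensity m χ v g p := by
  have hgrad (h : ℝ × ℝ → ℝ) : fderiv ℝ h p v ^ 2 ≤ gradSq h p := by
    rw [gradSq, Real.norm_eq_abs, Real.norm_eq_abs, sq_abs, sq_abs]
    rcases hv with rfl | rfl
    · exact le_add_of_nonneg_right (sq_nonneg _)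
    · exact le_add_of_nonneg_left (sq_nonneg _)
  have young (x y : ℝ) : |x * y| ≤ δ * x ^ 2 + δ⁻¹ * y ^ 2 := by
    have h := two_mul_le_add_mul_sq (a := |x|) (b := |y|) hδ
    rw [sq_abs, sq_abs] at h
    rw [abs_mul]
    linarith [mul_nonneg (abs_nonneg x) (abs_nonneg y)]
  have hsplit : m p * fderiv ℝ (fun q => χ q * (f q * g q)) p v =
      m p * (fderiv ℝ χ p v * f p) * g p + m p * (χ p * f p) * fderiv ℝ g p v +
        fderiv ℝ f p v * (m p * (χ p * g p)) := by
    rw [fderiv_mul_apply hχ (hf.fun_mul hg), fderiv_mul_apply hf hg]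
    ring
  rw [hsplit]
  have hf' := mul_le_mul_of_nonneg_left (hgrad f) hδ.le
  have hg' := mul_le_mul_of_nonneg_left (hgrad g) (inv_pos.2 hδ).le
  have h₁ := young (m p * (fderiv ℝ χ p v * f p)) (g p)
  have h₂ := young (m p * (χ p * f p)) (fderiv ℝ g p v)
  have h₃ := young (fderiv ℝ f p v) (m p * (χ p * g p))
  have n₁ : 0 ≤ δ * f p ^ 2 := by positivity
  have n₂ : 0 ≤ δ⁻¹ * (m p * (fderiv ℝ χ p v * g p)) ^ 2 := by positivity
  refine (abs_add_three _ _ _).trans ?_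
  simp only [productDensity]
  linarith

theorem IsMultiplier.exists_productDensity_bound {m : ℝ × ℝ → ℝ} (hm : IsMultiplier m)
    (hχ : tsupport χ ⊆ square a) (v : ℝ × ℝ) :
    ∃ C : ℝ, 0 ≤ C ∧ ∀ f : ℝ × ℝ → ℝ, ContDiff ℝ ∞ f →
      IntegrableOn (productDensity m χ v f) (square a) ∧
      ∫ p in square a, productDensity m χ v f p ≤ C * squareEnergy a f := by
  have hχ' : tsupport ((∂_{v} χ : Test ℝ) : ℝ × ℝ → ℝ) ⊆ square a := by
    refine (closure_minimal (fun p hp => ?_) (isClosed_tsupport χ)).trans hχ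
    contrapose! hp
    simp [lineDerivOp_apply, fderiv_of_notMem_tsupport ℝ hp]
  obtain ⟨C₁, hC₁, h₁⟩ := hm.exists_local_bound hχ'
  obtain ⟨C₂, hC₂, h₂⟩ := hm.exists_local_bound hχ
  simp only [lineDerivOp_apply] at h₁
  refine ⟨C₁ + C₂ + 1, by positivity, fun f hf => ?_⟩
  have i₁ : Integrable fun p => (m p * (fderiv ℝ χ p v * f p)) ^ 2 := by
    simp only [← lineDerivOp_apply]
    exact hm.integrable_mul_test_sq (testMul (∂_{v} χ) hf)
  have i₂ : Integrable fun p => (m p * (χ p * f p)) ^ 2 :=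
    hm.integrable_mul_test_sq (testMul χ hf)
  have i₃ : IntegrableOn (fun p => f p ^ 2 + gradSq f p) (square a) :=
    integrableOn_square ((hf.continuous.pow 2).add (continuous_gradSq (hf.of_le (by simp)))) a
  refine ⟨(i₁.add i₂).integrableOn.add i₃, ?_⟩
  have hle := setIntegral_le_integral (s := square a) (i₁.add i₂)
    (ae_of_all _ fun p => add_nonneg (sq_nonneg _) (sq_nonneg _))
  simp only [Pi.add_apply] at hle
  rw [integral_add i₁ i₂] at hle
  refine (integral_add (i₁.add i₂).integrableOn i₃).trans_le ?_
  rw [add_mul, add_mul, one_mul]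
  exact add_le_add (hle.trans (add_le_add (h₁ f hf) (h₂ f hf))) le_rfl

theorem IsMultiplier.exists_bilinear_bound {m : ℝ × ℝ → ℝ} (hm : IsMultiplier m)
    (hχ : tsupport χ ⊆ square a) {v : ℝ × ℝ} (hv : v = ex ∨ v = ey) :
    ∃ C : ℝ, 0 ≤ C ∧ ∀ f g : ℝ × ℝ → ℝ, ContDiff ℝ ∞ f → ContDiff ℝ ∞ g → ∀ δ : ℝ, 0 < δ →
      |∫ p, m p * fderiv ℝ (fun q => χ q * (f q * g q)) p v| ≤
        C * (δ * squareEnergy a f + δ⁻¹ * squareEnergy a g) := by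
  obtain ⟨C, hC, hbound⟩ := hm.exists_productDensity_bound hχ v
  refine ⟨C, hC, fun f g hf hg δ hδ => ?_⟩
  obtain ⟨hif, hf'⟩ := hbound f hf
  obtain ⟨hig, hg'⟩ := hbound g hg
  have hzero (p : ℝ × ℝ) (hp : p ∉ square a) :
      m p * fderiv ℝ (fun q => χ q * (f q * g q)) p v = 0 := by
    rw [fderiv_of_notMem_tsupport ℝ fun h => hp (hχ (tsupport_mul_subset_left h))]
    simp
  rw [← setIntegral_eq_integral_of_forall_compl_eq_zero hzero]
  refine (norm_integral_le_of_norm_le (f := fun p => m p * fderiv ℝ (fun q => χ q * _) p v)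
    (g := fun p => δ * productDensity m χ v f p + δ⁻¹ * productDensity m χ v g p)
    ((hif.const_mul δ).add (hig.const_mul δ⁻¹))
    (ae_of_all _ fun p => abs_mul_fderiv_mul_mul_le m (χ.contDiff.differentiable (by simp) p)
      (hf.differentiable (by simp) p) (hg.differentiable (by simp) p) hv hδ)).trans ?_
  rw [integral_add (hif.const_mul δ) (hig.const_mul δ⁻¹), integral_const_mul, integral_const_mul]
  calc _ ≤ δ * (C * squareEnergy a f) + δ⁻¹ * (C * squareEnergy a g) := by gcongr
    _ = _ := by ring

variable {B : ℝ × ℝ → ℝ}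

theorem IsVectorPotential.integral_field_mul {A : ℝ × ℝ → ℝ × ℝ} (hA : IsVectorPotential B A)
    (η : Test ℝ) :
    ∫ p, B p * η p = (∫ p, (A p).1 * fderiv ℝ η p ey) - ∫ p, (A p).2 * fderiv ℝ η p ex := by
  have h₁ := hA.isAdmissible.1.integrable_mul_test (∂_{ey} η)
  have h₂ := hA.isAdmissible.2.integrable_mul_test (∂_{ex} η)
  simp only [lineDerivOp_apply] at h₁ h₂
  rw [← integral_sub h₁ h₂, hA.rot_eq η η.contDiff η.hasCompactSupport]

theorem IsVectorPotential.exists_bilinear_bound {A : ℝ × ℝ → ℝ × ℝ} (hA : IsVectorPotential B A)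
    (hχ : tsupport χ ⊆ square a) :
    ∃ C : ℝ, 0 ≤ C ∧ ∀ f g : ℝ × ℝ → ℝ, ContDiff ℝ ∞ f → ContDiff ℝ ∞ g → ∀ δ : ℝ, 0 < δ →
      |∫ p, B p * (χ p * (f p * g p))| ≤
        C * (δ * squareEnergy a f + δ⁻¹ * squareEnergy a g) := by
  obtain ⟨C₁, hC₁, h₁⟩ := hA.isAdmissible.1.exists_bilinear_bound hχ (.inr rfl)
  obtain ⟨C₂, hC₂, h₂⟩ := hA.isAdmissible.2.exists_bilinear_bound hχ (.inl rfl)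
  refine ⟨C₁ + C₂, add_nonneg hC₁ hC₂, fun f g hf hg δ hδ => ?_⟩
  refine (congrArg abs (hA.integral_field_mul (testMul χ (hf.mul hg)))).trans_le ?_
  rw [add_mul]
  exact (abs_sub _ _).trans (add_le_add (h₁ f g hf hg δ hδ) (h₂ f g hf hg δ hδ))

theorem squareEnergy_add_const_le {w : ℝ × ℝ → ℝ} (hw : ContDiff ℝ 1 w) (a c : ℝ) :
    squareEnergy a (fun p => w p + c) ≤
      8 * (∫ p in square a, w p ^ 2) + 2 * squareEnergy a fun p => w p - c := by
  have h₁ : IntegrableOn (fun p => 8 * w p ^ 2) (square a) :=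
    (integrableOn_square (hw.continuous.pow 2) a).const_mul 8
  have h₂ {f : ℝ × ℝ → ℝ} (hf : ContDiff ℝ 1 f) :
      IntegrableOn (fun p => f p ^ 2 + gradSq f p) (square a) :=
    integrableOn_square ((hf.continuous.pow 2).add (continuous_gradSq hf)) a
  have hsub := (h₂ (hw.sub (contDiff_const (c := c)))).const_mul 2
  rw [squareEnergy, squareEnergy, ← integral_const_mul, ← integral_const_mul,
    ← integral_add h₁ hsub]
  refine setIntegral_mono (h₂ (hw.add contDiff_const)) (h₁.add hsub) fun p => ?_
  have hgrad := gradSq_nonneg w p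
  simp only [gradSq, fderiv_add_const, fderiv_sub_const] at hgrad ⊢
  linarith [sq_nonneg (2 * w p + (w p - c))]

theorem IsVectorPotential.exists_oscillation_bound {A : ℝ × ℝ → ℝ × ℝ} (ha : 0 < a)
    (hA : IsVectorPotential B A) (hχ : tsupport χ ⊆ square a) {δ : ℝ} (hδ : 0 < δ) :
    ∃ C : ℝ, 0 ≤ C ∧ ∀ w : ℝ × ℝ → ℝ, ContDiff ℝ ∞ w → ∃ c : ℝ,
      ∫ p in square a, (w p - c) ^ 2 ≤ 8 * a ^ 2 * ∫ p in square a, gradSq w p ∧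
      |∫ p, B p * (χ p * (w p ^ 2 - c ^ 2))| ≤
        δ * (∫ p in square a, w p ^ 2) + C * ∫ p in square a, gradSq w p := by
  obtain ⟨C, hC, hbilin⟩ := hA.exists_bilinear_bound hχ
  set t := δ / (8 * (C + 1)) with ht
  have ht0 : 0 < t := by positivity
  have hCt : C * t * 8 ≤ δ := by
    have : (C + 1) * t * 8 = δ := by rw [ht]; field_simp
    linarith
  refine ⟨C * (t⁻¹ + 2 * t) * (8 * a ^ 2 + 1), by positivity, fun w hw => ?_⟩
  have hw₁ : ContDiff ℝ 1 w := hw.of_le (by simp)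
  obtain ⟨c, hc⟩ := exists_setIntegral_sq_sub_le hw₁ ha
  refine ⟨c, hc, ?_⟩
  have hminus : squareEnergy a (fun p => w p - c) ≤
      (8 * a ^ 2 + 1) * ∫ p in square a, gradSq w p := by
    rw [squareEnergy_eq (hw₁.sub contDiff_const), add_mul, one_mul]
    refine add_le_add hc (le_of_eq ?_)
    simp only [gradSq, fderiv_sub_const]
  have hplus := squareEnergy_add_const_le hw₁ a c
  simp only [sq_sub_sq]
  refine (hbilin _ _ (hw.add contDiff_const) (hw.sub contDiff_const) t ht0).trans ?_
  calc _ ≤ C * (t * (8 * (∫ p in square a, w p ^ 2) + 2 * squareEnergy a fun p => w p - c) +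
          t⁻¹ * squareEnergy a fun p => w p - c) := by gcongr
    _ = C * t * 8 * (∫ p in square a, w p ^ 2) +
          C * (t⁻¹ + 2 * t) * squareEnergy a fun p => w p - c := by ring
    _ ≤ _ := by
      rw [mul_assoc (C * (t⁻¹ + 2 * t))]
      gcongr

end FieldBounds

section MagneticCommutator

/-- The component `Im (φ̄ ∂_v φ)` of the probability current of a wave function `φ`. -/
def current {E : Type*} [NormedAddCommGroup E] [NormedSpace ℝ E] (v : E) (φ : E → ℂ) (p : E) : ℝ :=
  (star (φ p) * fderiv ℝ φ p v).im

theorem fderiv_fderiv_apply_comm {E F : Type*} [NormedAddCommGroup E] [NormedSpace ℝ E]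
    [NormedAddCommGroup F] [NormedSpace ℝ F] {f : E → F} (hf : ContDiff ℝ 2 f) (p v w : E) :
    fderiv ℝ (fun q => fderiv ℝ f q v) p w = fderiv ℝ (fun q => fderiv ℝ f q w) p v := by
  have hd : DifferentiableAt ℝ (fderiv ℝ f) p :=
    (hf.fderiv_right (m := 1) (by norm_num)).differentiable one_ne_zero p
  have hsymm : IsSymmSndFDerivAt ℝ f p :=
    hf.contDiffAt.isSymmSndFDerivAt (by rw [minSmoothness_of_isRCLikeNormedField])
  simpa [fderiv_clm_apply hd (differentiableAt_const _)] using hsymm.eq w v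

theorem fderiv_im_star_mul {E : Type*} [NormedAddCommGroup E] [NormedSpace ℝ E] {f g : E → ℂ}
    {p : E} (hf : DifferentiableAt ℝ f p) (hg : DifferentiableAt ℝ g p) (v : E) :
    fderiv ℝ (fun q => (star (f q) * g q).im) p v =
      (star (fderiv ℝ f p v) * g p).im + (star (f p) * fderiv ℝ g p v).im := by
  have h : HasFDerivAt (fun q => (star (f q) * g q).im) _ p :=
    Complex.imCLM.hasFDerivAt.comp p (hf.hasFDerivAt.star.mul hg.hasFDerivAt)
  rw [h.fderiv]
  simp
  ring

theorem fderiv_current_sub_fderiv_current {E : Type*} [NormedAddCommGroup E] [NormedSpace ℝ E]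
    {φ : E → ℂ} (hφ : ContDiff ℝ 2 φ) (p v w : E) :
    fderiv ℝ (current w φ) p v - fderiv ℝ (current v φ) p w =
      2 * (star (fderiv ℝ φ p v) * fderiv ℝ φ p w).im := by
  have hd : DifferentiableAt ℝ φ p := hφ.differentiable two_ne_zero p
  have hd' (u : E) : DifferentiableAt ℝ (fun q => fderiv ℝ φ q u) p :=
    ((hφ.fderiv_right (m := 1) (by norm_num)).differentiable one_ne_zero p).clm_apply
      (differentiableAt_const u)
  unfold current
  rw [fderiv_im_star_mul hd (hd' w), fderiv_im_star_mul hd (hd' v), fderiv_fderiv_apply_comm hφ p v]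
  simp only [Complex.star_def, Complex.mul_im, Complex.conj_re, Complex.conj_im]
  ring

theorem contDiff_current (v : ℝ × ℝ) (φ : Test ℂ) : ContDiff ℝ ∞ (current v φ) :=
  Complex.imCLM.contDiff.comp
    (((starL' ℝ (A := ℂ)).contDiff.comp φ.contDiff).mul (contDiff_fderiv_apply φ.contDiff v))

/-- The commutator of the covariant derivatives of `φ`, paired with `χ φ` and integrated by parts
so that no derivative falls on them; it differs from the field term by a divergence. -/
def gaugeCommutator (A : ℝ × ℝ → ℝ × ℝ) (χ : ℝ × ℝ → ℝ) (φ : ℝ × ℝ → ℂ) (p : ℝ × ℝ) : ℝ :=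
  fderiv ℝ χ p ey * (star (φ p) * covDeriv (fun q => (A q).1) ex φ p).re
    - fderiv ℝ χ p ex * (star (φ p) * covDeriv (fun q => (A q).2) ey φ p).re
    + χ p * (2 * (star (covDeriv (fun q => (A q).1) ex φ p) *
        covDeriv (fun q => (A q).2) ey φ p).im)

theorem gaugeCommutator_add_divergence (A : ℝ × ℝ → ℝ × ℝ) {χ : ℝ × ℝ → ℝ} (hχ : ContDiff ℝ ∞ χ)
    (φ : Test ℂ) (p : ℝ × ℝ) :
    gaugeCommutator A χ φ p + (fderiv ℝ (fun q => χ q * current ex φ q) p ey -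
        fderiv ℝ (fun q => χ q * current ey φ q) p ex) =
      (A p).1 * fderiv ℝ (fun q => χ q * ‖φ q‖ ^ 2) p ey -
        (A p).2 * fderiv ℝ (fun q => χ q * ‖φ q‖ ^ 2) p ex := by
  have dχ : DifferentiableAt ℝ χ p := hχ.differentiable (by simp) p
  have dφ : DifferentiableAt ℝ φ p := φ.contDiff.differentiable (by simp) p
  have dsq : DifferentiableAt ℝ (fun q => ‖φ q‖ ^ 2) p := dφ.norm_sq ℝ
  have dcur (v : ℝ × ℝ) : DifferentiableAt ℝ (current v φ) p :=
    (contDiff_current v φ).differentiable (by simp) p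
  have hφ : ContDiff ℝ 2 φ := by exact_mod_cast contDiff_infty.1 φ.contDiff 2
  rw [fderiv_mul_apply dχ (dcur ex), fderiv_mul_apply dχ (dcur ey), fderiv_mul_apply dχ dsq,
    fderiv_mul_apply dχ dsq, fderiv_norm_sq_comp_apply dφ, fderiv_norm_sq_comp_apply dφ,
    eq_add_of_sub_eq (fderiv_current_sub_fderiv_current hφ p ex ey)]
  simp only [gaugeCommutator, covDeriv, current, Complex.inner, Complex.sq_norm,
    Complex.normSq_apply, Complex.star_def, Complex.mul_re, Complex.mul_im, Complex.add_re,
    Complex.add_im, Complex.I_re, Complex.I_im, Complex.ofReal_re, Complex.ofReal_im,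
    Complex.conj_re, Complex.conj_im]
  ring

theorem abs_gaugeCommutator_le (A : ℝ × ℝ → ℝ × ℝ) {χ : ℝ × ℝ → ℝ} (φ : ℝ × ℝ → ℂ) {p : ℝ × ℝ}
    {M δ : ℝ} (hδ : 0 < δ) (h₀ : |χ p| ≤ M) (hx : |fderiv ℝ χ p ex| ≤ M)
    (hy : |fderiv ℝ χ p ey| ≤ M) :
    |gaugeCommutator A χ φ p| ≤ δ * ‖φ p‖ ^ 2 + (δ⁻¹ * M ^ 2 / 2 + M) * magSq A φ p := by
  have hM : 0 ≤ M := (abs_nonneg _).trans h₀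
  unfold gaugeCommutator magSq
  set d₁ := covDeriv (fun q => (A q).1) ex φ p
  set d₂ := covDeriv (fun q => (A q).2) ey φ p
  have hre (z w : ℂ) : |(star z * w).re| ≤ ‖z‖ * ‖w‖ := by
    simpa using Complex.abs_re_le_norm (star z * w)
  have him (z w : ℂ) : |(star z * w).im| ≤ ‖z‖ * ‖w‖ := by
    simpa using Complex.abs_im_le_norm (star z * w)
  calc _ ≤ |fderiv ℝ χ p ey| * |(star (φ p) * d₁).re| +
          |fderiv ℝ χ p ex| * |(star (φ p) * d₂).re| + |χ p| * (2 * |(star d₁ * d₂).im|) := by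
        refine (abs_add_le _ _).trans ?_
        rw [abs_mul (χ p), abs_mul 2, abs_two]
        gcongr
        exact (abs_sub _ _).trans_eq (by rw [abs_mul, abs_mul])
    _ ≤ M * (‖φ p‖ * ‖d₁‖) + M * (‖φ p‖ * ‖d₂‖) + M * (2 * (‖d₁‖ * ‖d₂‖)) := by
        gcongr
        exacts [hre _ _, hre _ _, him _ _]
    _ ≤ _ := by
        have young₁ := two_mul_le_add_mul_sq (a := ‖φ p‖) (b := M * ‖d₁‖) hδ
        have young₂ := two_mul_le_add_mul_sq (a := ‖φ p‖) (b := M * ‖d₂‖) hδ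
        have young₃ := mul_le_mul_of_nonneg_left (two_mul_le_add_sq ‖d₁‖ ‖d₂‖) hM
        rw [mul_pow] at young₁ young₂
        linarith

theorem integral_fderiv_test (η : Test ℝ) (v : ℝ × ℝ) :
    Integrable (fun p => fderiv ℝ η p v) ∧ ∫ p, fderiv ℝ η p v = 0 := by
  have integrable (ξ : Test ℝ) : Integrable ξ :=
    ξ.contDiff.continuous.integrable_of_hasCompactSupport ξ.hasCompactSupport
  have hη_int : Integrable fun p => fderiv ℝ η p v := by
    simp only [← lineDerivOp_apply]
    exact integrable _
  refine ⟨hη_int, ?_⟩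
  simpa using integral_mul_fderiv_eq_neg_fderiv_mul_of_integrable (μ := volume)
    (f := fun _ : ℝ × ℝ => (1 : ℝ)) (g := η) (v := v) (by simp) (by simpa using hη_int)
    (by simpa using integrable η) (fun p _ => differentiableAt_const _)
    (fun p _ => η.contDiff.differentiable (by simp) p)

theorem IsVectorPotential.integral_field_mul_norm_sq {B : ℝ × ℝ → ℝ} {A : ℝ × ℝ → ℝ × ℝ}
    (hA : IsVectorPotential B A) (χ : Test ℝ) (φ : Test ℂ) :
    ∫ p, B p * (χ p * ‖φ p‖ ^ 2) = ∫ p, gaugeCommutator A χ φ p := by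
  set η := testMul χ (φ.contDiff.norm_sq ℝ)
  obtain ⟨ix, hx⟩ := integral_fderiv_test (testMul χ (contDiff_current ex φ)) ey
  obtain ⟨iy, hy⟩ := integral_fderiv_test (testMul χ (contDiff_current ey φ)) ex
  have h₁ := hA.isAdmissible.1.integrable_mul_test (∂_{ey} η)
  have h₂ := hA.isAdmissible.2.integrable_mul_test (∂_{ex} η)
  simp only [lineDerivOp_apply] at h₁ h₂
  calc ∫ p, B p * η p = ∫ p, ((A p).1 * fderiv ℝ η p ey - (A p).2 * fderiv ℝ η p ex) :=
        (hA.rot_eq η η.contDiff η.hasCompactSupport).symm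
    _ = (∫ p, ((A p).1 * fderiv ℝ η p ey - (A p).2 * fderiv ℝ η p ex)) -
          ∫ p, (fderiv ℝ (testMul χ (contDiff_current ex φ)) p ey -
            fderiv ℝ (testMul χ (contDiff_current ey φ)) p ex) := by
        rw [integral_sub ix iy, hx, hy, sub_zero, sub_zero]
    _ = ∫ p, ((A p).1 * fderiv ℝ η p ey - (A p).2 * fderiv ℝ η p ex -
          (fderiv ℝ (testMul χ (contDiff_current ex φ)) p ey -
            fderiv ℝ (testMul χ (contDiff_current ey φ)) p ex)) :=
        (integral_sub (h₁.sub h₂) (ix.sub iy)).symm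
    _ = ∫ p, gaugeCommutator A χ φ p := integral_congr_ae <| ae_of_all _ fun p =>
        sub_eq_of_eq_add (gaugeCommutator_add_divergence A χ.contDiff φ p).symm

theorem exists_field_mul_norm_sq_bound {a : ℝ} {χ : Test ℝ} (hχ : tsupport χ ⊆ square a) {δ : ℝ}
    (hδ : 0 < δ) :
    ∃ C : ℝ, 0 ≤ C ∧ ∀ (B : ℝ × ℝ → ℝ) (A : ℝ × ℝ → ℝ × ℝ), IsVectorPotential B A →
      ∀ φ : Test ℂ, |∫ p, B p * (χ p * ‖φ p‖ ^ 2)| ≤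
        δ * (∫ p in square a, ‖φ p‖ ^ 2) + C * ∫ p in square a, magSq A φ p := by
  obtain ⟨M, hM, hbound⟩ := exists_bound_test χ
  refine ⟨δ⁻¹ * M ^ 2 / 2 + M, by positivity, fun B A hA φ => ?_⟩
  have hzero (p : ℝ × ℝ) (hp : p ∉ square a) : gaugeCommutator A χ φ p = 0 := by
    have hp' : p ∉ tsupport χ := fun h => hp (hχ h)
    simp [gaugeCommutator, fderiv_of_notMem_tsupport ℝ hp', image_eq_zero_of_notMem_tsupport hp']
  have hφ := ((integrable_norm_sq φ).const_mul δ).integrableOn (s := square a)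
  have hmag := ((hA.isAdmissible.integrable_magSq φ).const_mul
    (δ⁻¹ * M ^ 2 / 2 + M)).integrableOn (s := square a)
  rw [hA.integral_field_mul_norm_sq, ← setIntegral_eq_integral_of_forall_compl_eq_zero hzero,
    ← integral_const_mul, ← integral_const_mul, ← integral_add hφ hmag]
  exact norm_integral_le_of_norm_le (f := gaugeCommutator A χ φ) (hφ.add hmag) <|
    ae_of_all _ fun p => abs_gaugeCommutator_le A φ hδ (hbound p).1 (hbound p).2.1 (hbound p).2.2

end MagneticCommutator

section Hardy

variable {a : ℝ} {B : ℝ × ℝ → ℝ}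

theorem exists_test_integral_mul_ne_zero {Ω : Set (ℝ × ℝ)} (hΩ : IsOpen Ω)
    (hB : LocallyIntegrable B volume) (hB0 : ¬ B =ᵐ[volume.restrict Ω] 0) :
    ∃ χ : Test ℝ, tsupport χ ⊆ Ω ∧ ∫ p, B p * χ p ≠ 0 := by
  by_contra! h
  refine hB0 ((ae_restrict_iff' hΩ.measurableSet).2 ?_)
  refine hΩ.ae_eq_zero_of_integral_contDiff_smul_eq_zero (hB.locallyIntegrableOn Ω) ?_
  intro χ hχ hc hs
  simpa [mul_comm] using h ⟨χ, hχ, hc, subset_univ _⟩ hs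

theorem integrable_field_mul (hB : LocallyIntegrable B volume) (η : Test ℝ) :
    Integrable fun p => B p * η p := by
  simpa [mul_comm] using
    hB.integrable_smul_left_of_hasCompactSupport η.contDiff.continuous η.hasCompactSupport

theorem setIntegral_sq_le_of_sub_const {w : ℝ × ℝ → ℝ} (hw : Continuous w) (ha : 0 ≤ a) (c : ℝ) :
    ∫ p in square a, w p ^ 2 ≤ 2 * c ^ 2 * (2 * a) ^ 2 + 2 * ∫ p in square a, (w p - c) ^ 2 := by
  have hconst := integrableOn_square (F := fun _ => 2 * c ^ 2) continuous_const a
  have hdiff : IntegrableOn (fun p => 2 * (w p - c) ^ 2) (square a) :=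
    (integrableOn_square ((hw.sub continuous_const).pow 2) a).const_mul 2
  have harea : ∫ _ in square a, 2 * c ^ 2 = 2 * c ^ 2 * (2 * a) ^ 2 := by
    rw [setIntegral_const, volume_real_square ha, smul_eq_mul, mul_comm]
  rw [← harea, ← integral_const_mul, ← integral_add hconst hdiff]
  refine setIntegral_mono (integrableOn_square (hw.pow 2) a) (hconst.add hdiff) fun p => ?_
  change w p ^ 2 ≤ 2 * c ^ 2 + 2 * (w p - c) ^ 2
  linarith [sq_nonneg (w p - 2 * c)]

theorem setIntegral_regNorm_sq (ha : 0 ≤ a) (ε : ℝ) (φ : Test ℂ) :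
    ∫ p in square a, regNorm ε φ p ^ 2 =
      (∫ p in square a, ‖φ p‖ ^ 2) + ε ^ 2 * (2 * a) ^ 2 := by
  simp only [regNorm_sq]
  rw [integral_add (integrable_norm_sq φ).integrableOn
    (integrableOn_square (F := fun _ => ε ^ 2) continuous_const a), setIntegral_const,
    volume_real_square ha, smul_eq_mul, mul_comm (ε ^ 2)]

theorem IsAdmissible.setIntegral_gradSq_regNorm_le {A : ℝ × ℝ → ℝ × ℝ} (hA : IsAdmissible A)
    (a : ℝ) {ε : ℝ} (hε : 0 < ε) (φ : Test ℂ) :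
    ∫ p in square a, gradSq (regNorm ε φ) p ≤ ∫ p in square a, magSq A φ p :=
  setIntegral_mono
    (integrableOn_square (continuous_gradSq ((contDiff_regNorm hε φ.contDiff).of_le (by simp))) a)
    (hA.integrable_magSq φ).integrableOn
    fun p => gradSq_regNorm_le A hε (φ.contDiff.differentiable (by simp) p)

theorem sq_mul_abs_integral_le (hB : LocallyIntegrable B volume) (χ : Test ℝ) (φ : Test ℂ)
    (ε c : ℝ) :
    c ^ 2 * |∫ p, B p * χ p| ≤ |∫ p, B p * (χ p * (regNorm ε φ p ^ 2 - c ^ 2))| +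
      |∫ p, B p * (χ p * ‖φ p‖ ^ 2)| + ε ^ 2 * |∫ p, B p * χ p| := by
  have hφ : Integrable fun p => B p * (χ p * ‖φ p‖ ^ 2) :=
    integrable_field_mul hB (testMul χ (φ.contDiff.norm_sq ℝ))
  have hsplit : ∫ p, B p * (χ p * (regNorm ε φ p ^ 2 - c ^ 2)) =
      (∫ p, B p * (χ p * ‖φ p‖ ^ 2)) + (ε ^ 2 - c ^ 2) * ∫ p, B p * χ p := by
    rw [← integral_const_mul, ← integral_add hφ ((integrable_field_mul hB χ).const_mul _)]
    refine integral_congr_ae (ae_of_all _ fun p => ?_)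
    simp only [regNorm_sq]
    ring
  set b := ∫ p, B p * χ p
  set J := ∫ p, B p * (χ p * ‖φ p‖ ^ 2)
  have hb : c ^ 2 * b = -(J + (ε ^ 2 - c ^ 2) * b) + J + ε ^ 2 * b := by ring
  have habs (t : ℝ) : t ^ 2 * |b| = |t ^ 2 * b| := by rw [abs_mul, abs_sq]
  rw [hsplit, habs, habs, ← abs_neg (J + _)]
  conv_lhs => rw [hb]
  exact abs_add_three _ _ _

-- Bounding the oscillation through a reference potential `A₀` makes `C` independent of `A`.
theorem IsVectorPotential.exists_const_bound {A₀ : ℝ × ℝ → ℝ × ℝ} (ha : 0 < a)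
    (hB : LocallyIntegrable B volume) (hA₀ : IsVectorPotential B A₀) {χ : Test ℝ}
    (hχ : tsupport χ ⊆ square a) {δ : ℝ} (hδ : 0 < δ) :
    ∃ C : ℝ, 0 ≤ C ∧ ∀ A, IsVectorPotential B A → ∀ (φ : Test ℂ) (ε : ℝ), 0 < ε → ∃ c : ℝ,
      ∫ p in square a, (regNorm ε φ p - c) ^ 2 ≤ 8 * a ^ 2 * ∫ p in square a, magSq A φ p ∧
      c ^ 2 * |∫ p, B p * χ p| ≤ 2 * δ * (∫ p in square a, regNorm ε φ p ^ 2) +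
        C * (∫ p in square a, magSq A φ p) + ε ^ 2 * |∫ p, B p * χ p| := by
  obtain ⟨C₁, hC₁, hosc⟩ := hA₀.exists_oscillation_bound ha hχ hδ
  obtain ⟨C₂, hC₂, hmag⟩ := exists_field_mul_norm_sq_bound hχ hδ
  refine ⟨C₁ + C₂, add_nonneg hC₁ hC₂, fun A hA φ ε hε => ?_⟩
  obtain ⟨c, hpoincare, hfield⟩ := hosc _ (contDiff_regNorm hε φ.contDiff)
  have hdia := hA.isAdmissible.setIntegral_gradSq_regNorm_le a hε φ
  refine ⟨c, hpoincare.trans (mul_le_mul_of_nonneg_left hdia (by positivity)), ?_⟩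
  have hφ : ∫ p in square a, ‖φ p‖ ^ 2 ≤ ∫ p in square a, regNorm ε φ p ^ 2 := by
    rw [setIntegral_regNorm_sq ha.le]
    exact le_add_of_nonneg_right (by positivity)
  linarith [sq_mul_abs_integral_le hB χ φ ε c, hmag B A hA φ,
    mul_le_mul_of_nonneg_left hdia hC₁, mul_le_mul_of_nonneg_left hφ hδ.le]

theorem IsVectorPotential.exists_regularized_hardy {A₀ : ℝ × ℝ → ℝ × ℝ} (ha : 0 < a)
    (hB : LocallyIntegrable B volume) (hB0 : ¬ B =ᵐ[volume.restrict (square a)] 0)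
    (hA₀ : IsVectorPotential B A₀) :
    ∃ K : ℝ, 0 ≤ K ∧ ∀ A, IsVectorPotential B A → ∀ (φ : Test ℂ) (ε : ℝ), 0 < ε →
      ∫ p in square a, ‖φ p‖ ^ 2 ≤
        K * (∫ p in square a, magSq A φ p) + 4 * (2 * a) ^ 2 * ε ^ 2 := by
  obtain ⟨χ, hχ, hb⟩ := exists_test_integral_mul_ne_zero (isOpen_Ioo.prod isOpen_Ioo) hB hB0
  set b := |∫ p, B p * χ p|
  have hb0 : 0 < b := abs_pos.2 hb
  set q := (2 * a) ^ 2 with hq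
  have hq0 : 0 < q := by positivity
  set δ := b / (8 * q) with hδ
  obtain ⟨C, hC, hconst⟩ := hA₀.exists_const_bound ha hB hχ (show 0 < δ by positivity)
  refine ⟨4 * q * C / b + 32 * a ^ 2, by positivity, fun A hA φ ε hε => ?_⟩
  obtain ⟨c, hosc, hc⟩ := hconst A hA φ ε hε
  have hsq := setIntegral_sq_le_of_sub_const (contDiff_regNorm hε φ.contDiff).continuous ha.le c
  have hreg := setIntegral_regNorm_sq ha.le ε φ
  rw [← hq] at hreg hsq
  set Y := ∫ p in square a, magSq A φ p
  set X := ∫ p in square a, regNorm ε φ p ^ 2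
  have hX : X ≤ 2 * c ^ 2 * q + 16 * a ^ 2 * Y := by linarith
  have habsorb : b / 2 * X ≤ 2 * q * C * Y + 2 * q * ε ^ 2 * b + 16 * a ^ 2 * b * Y := by
    have hδq : 4 * q * δ * X = b / 2 * X := by rw [hδ]; field_simp; ring
    linarith [mul_le_mul_of_nonneg_left hX hb0.le,
      mul_le_mul_of_nonneg_left hc (by positivity : 0 ≤ 2 * q)]
  have hle : ∫ p in square a, ‖φ p‖ ^ 2 ≤ X := hreg ▸ le_add_of_nonneg_right (by positivity)
  refine hle.trans (le_of_mul_le_mul_left (habsorb.trans_eq ?_) (half_pos hb0))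
  field_simp
  ring

theorem exists_hardy (ha : 0 < a) (hB : LocallyIntegrable B volume)
    (hB0 : ¬ B =ᵐ[volume.restrict (square a)] 0) :
    ∃ K : ℝ, 0 ≤ K ∧ ∀ A, IsVectorPotential B A → ∀ φ : Test ℂ,
      ∫ p in square a, ‖φ p‖ ^ 2 ≤ K * ∫ p in square a, magSq A φ p := by
  by_cases hex : ∃ A₀, IsVectorPotential B A₀
  · obtain ⟨A₀, hA₀⟩ := hex
    obtain ⟨K, hK, hreg⟩ := hA₀.exists_regularized_hardy ha hB hB0
    refine ⟨K, hK, fun A hA φ => le_of_forall_pos_le_add fun η hη => ?_⟩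
    refine (hreg A hA φ √(η / (4 * (2 * a) ^ 2)) (by positivity)).trans_eq ?_
    rw [Real.sq_sqrt (by positivity), mul_div_cancel₀ η (by positivity)]
  · exact ⟨0, le_rfl, fun A hA => (hex ⟨A, hA⟩).elim⟩

end Hardy

section LowerBound

theorem deriv_eq_one_of_lt_abs {a : ℝ} {γ : ℝ → ℝ} (h : ∀ x, a ≤ |x| → γ x = x) {x : ℝ}
    (hx : a < |x|) : deriv γ x = 1 := by
  have hid : γ =ᶠ[𝓝 x] id := by
    filter_upwards [continuous_abs.continuousAt.eventually (lt_mem_nhds hx)] with y hy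
    exact h y hy.le
  rw [hid.deriv_eq, deriv_id]

theorem setIntegral_speed_compl_Ioo {a : ℝ} {γ : ℝ → ℝ} (h : ∀ x, a ≤ |x| → γ x = x)
    (F : ℝ × ℝ → ℝ) :
    ∫ x in (Ioo (-a) a)ᶜ, speed γ x * F (x, γ x) = √2 * ∫ x in (Ioo (-a) a)ᶜ, F (x, x) := by
  rw [← integral_const_mul]
  refine setIntegral_congr_ae measurableSet_Ioo.compl ?_
  filter_upwards [Measure.ae_ne volume a, Measure.ae_ne volume (-a)] with x hxa hxa' hx
  have hle : a ≤ |x| := not_lt.1 fun hlt => hx (abs_lt.1 hlt)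
  have hne : a ≠ |x| := by
    rintro rfl
    exact (abs_choice x).elim (fun he => hxa he.symm) fun he => hxa' (by rw [he, neg_neg])
  rw [speed, deriv_eq_one_of_lt_abs h (hle.lt_of_ne hne), h x hle, one_pow, one_add_one_eq_two]

variable {a : ℝ} {A : ℝ × ℝ → ℝ × ℝ} {γ : ℝ → ℝ} {α : ℝ}

theorem IsAdmissible.mul_setIntegral_Ioo_speed_le (hA : IsAdmissible A) {W : ℝ}
    (hγ : HasSpeedLE γ W) (ha : 0 < a) (hγa : ∀ x, |x| < a → |γ x| ≤ a) (hα : 0 ≤ α) {K : ℝ}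
    {φ : Test ℂ} (hK : ∫ p in square a, ‖φ p‖ ^ 2 ≤ K * ∫ p in square a, magSq A φ p)
    (hsmall : α * W * (((2 * a)⁻¹ + 1) * K + 1) ≤ 1) :
    α * ∫ x in Ioo (-a) a, speed γ x * ‖φ (x, γ x)‖ ^ 2 ≤ ∫ p in square a, magSq A φ p := by
  set M := ∫ p in square a, magSq A φ p
  have hM : 0 ≤ M := integral_nonneg (magSq_nonneg A φ)
  have hW := hγ.nonneg
  calc α * ∫ x in Ioo (-a) a, speed γ x * ‖φ (x, γ x)‖ ^ 2
      ≤ α * (W * ∫ x in Ioo (-a) a, ‖φ (x, γ x)‖ ^ 2) := by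
        gcongr
        exact hγ.setIntegral_speed_mul_le φ _
    _ ≤ α * (W * (((2 * a)⁻¹ + 1) * (K * M) + M)) := by
        gcongr
        refine (hA.setIntegral_norm_sq_graph_le hγ.continuous ha hγa φ).trans ?_
        gcongr
    _ = α * W * (((2 * a)⁻¹ + 1) * K + 1) * M := by ring
    _ ≤ M := mul_le_of_le_one_left hM hsmall

theorem IsAdmissible.mul_setIntegral_compl_Ioo_speed_le (hA : IsAdmissible A)
    (h : ∀ x, a ≤ |x| → γ x = x) (hα : 0 ≤ α) (φ : Test ℂ) :
    α * ∫ x in (Ioo (-a) a)ᶜ, speed γ x * ‖φ (x, γ x)‖ ^ 2 ≤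
      (∫ p in (square a)ᶜ, magSq A φ p) + α ^ 2 / 4 * ∫ p, ‖φ p‖ ^ 2 := by
  set T : Set (ℝ × ℝ) := {p | (p.1 + p.2) / 2 ∈ (Ioo (-a) a)ᶜ}
  have hTsub : T ⊆ (square a)ᶜ := by
    rintro p hp ⟨⟨h1, h2⟩, h3, h4⟩
    exact hp ⟨by linarith, by linarith⟩
  have hmag := hA.integrable_magSq φ
  have hφ := (integrable_norm_sq φ).const_mul (α ^ 2 / 4)
  have hκ : (α / √2) ^ 2 / 2 = α ^ 2 / 4 := by
    rw [div_pow, Real.sq_sqrt zero_le_two]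
    ring
  have hdiag := hA.setIntegral_norm_sq_diagonal_le (κ := α / √2) (by positivity)
    (measurableSet_Ioo (a := -a) (b := a)).compl φ
  rw [hκ] at hdiag
  calc α * ∫ x in (Ioo (-a) a)ᶜ, speed γ x * ‖φ (x, γ x)‖ ^ 2
      = 2 * (α / √2) * ∫ x in (Ioo (-a) a)ᶜ, ‖φ (x, x)‖ ^ 2 := by
        rw [setIntegral_speed_compl_Ioo h fun p => ‖φ p‖ ^ 2, mul_div_left_comm, Real.div_sqrt,
          mul_assoc]
    _ ≤ ∫ p in T, (magSq A φ p + α ^ 2 / 4 * ‖φ p‖ ^ 2) := hdiag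
    _ = (∫ p in T, magSq A φ p) + ∫ p in T, α ^ 2 / 4 * ‖φ p‖ ^ 2 :=
        integral_add hmag.integrableOn hφ.integrableOn
    _ ≤ _ := by
        rw [← integral_const_mul]
        exact add_le_add
          (setIntegral_mono_set hmag.integrableOn (ae_of_all _ (magSq_nonneg A φ))
            hTsub.eventuallyLE)
          (setIntegral_le_integral hφ (ae_of_all _ fun p => by positivity))

theorem IsAdmissible.mul_norm_sq_testToLp_le (hA : IsAdmissible A)
    [IsFiniteMeasureOnCompacts (arcLength γ)] {W : ℝ} (hW : HasSpeedLE γ W)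
    (ha : 0 < a) (hγ : ∀ x, a ≤ |x| → γ x = x) (hγa : ∀ x, |x| < a → |γ x| ≤ a) (hα : 0 ≤ α) {K : ℝ}
    (hsmall : α * W * (((2 * a)⁻¹ + 1) * K + 1) ≤ 1) {φ : Test ℂ}
    (hK : ∫ p in square a, ‖φ p‖ ^ 2 ≤ K * ∫ p in square a, magSq A φ p) :
    α * ‖testToLp (arcLength γ) φ‖ ^ 2 ≤
      (∫ p, magSq A φ p) + α ^ 2 / 4 * ∫ p, ‖φ p‖ ^ 2 := by
  rw [norm_sq_testToLp_arcLength hW.continuous,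
    ← integral_add_compl measurableSet_Ioo (hW.integrable_speed_mul φ),
    ← integral_add_compl (measurableSet_square a) (hA.integrable_magSq φ), mul_add, add_assoc]
  exact add_le_add (hA.mul_setIntegral_Ioo_speed_le hW ha hγa hα hK hsmall)
    (hA.mul_setIntegral_compl_Ioo_speed_le hγ hα φ)

end LowerBound

section CovariantDerivative

namespace IsMultiplier

variable {m : ℝ × ℝ → ℝ} (hm : IsMultiplier m)

/-- The covariant derivative as a bounded operator from `H¹(ℝ²)` to `L²(ℝ²)`: in the direction `x`
for `i = 1` and in the direction `y` for `i = 2`, the indices being those of `coord`. -/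
def covOp (i : Fin 3) : sobolev →L[ℂ] L2 := Complex.I • coord i + hm.mulOp

theorem coeFn_covOp (i : Fin 3) (u : sobolev) :
    hm.covOp i u =ᵐ[volume] fun p => Complex.I * coord i u p + (m p : ℂ) * coord 0 u p := by
  filter_upwards [Lp.coeFn_add (Complex.I • coord i u) (hm.mulOp u),
    Lp.coeFn_smul Complex.I (coord i u), hm.coeFn_mulOp u] with p hadd hsmul hmul
  change (Complex.I • coord i u + hm.mulOp u : L2) p = _
  rw [hadd, Pi.add_apply, hsmul, hmul, Pi.smul_apply, smul_eq_mul]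

theorem coeFn_covOp_testToSobolev {i : Fin 3} {v : ℝ × ℝ} {φ : Test ℂ}
    (h : coord i (testToSobolev φ) = testToLp volume (LineDeriv.lineDerivOp v φ)) :
    hm.covOp i (testToSobolev φ) =ᵐ[volume] covDeriv m v φ := by
  filter_upwards [hm.coeFn_covOp i (testToSobolev φ), coeFn_testToLp volume φ,
    coeFn_testToLp_lineDeriv v φ] with p hcov hφ hderiv
  rw [hcov, h, coord_zero_testToSobolev, hφ, hderiv, covDeriv]

theorem norm_sq_covOp_one_testToSobolev (φ : Test ℂ) :
    ‖hm.covOp 1 (testToSobolev φ)‖ ^ 2 = ∫ p, ‖covDeriv m ex φ p‖ ^ 2 :=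
  norm_sq_eq_integral (hm.coeFn_covOp_testToSobolev (coord_one_testToSobolev φ))

theorem norm_sq_covOp_two_testToSobolev (φ : Test ℂ) :
    ‖hm.covOp 2 (testToSobolev φ)‖ ^ 2 = ∫ p, ‖covDeriv m ey φ p‖ ^ 2 :=
  norm_sq_eq_integral (hm.coeFn_covOp_testToSobolev (coord_two_testToSobolev φ))

theorem norm_sq_coord_le (i : Fin 3) (u : sobolev) :
    ‖coord i u‖ ^ 2 ≤ 2 * (‖hm.covOp i u‖ ^ 2 + ‖hm.mulOp u‖ ^ 2) := by
  have hcoord : Complex.I • coord i u = hm.covOp i u - hm.mulOp u := by simp [covOp]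
  have hnorm : ‖coord i u‖ ≤ ‖hm.covOp i u‖ + ‖hm.mulOp u‖ := by
    simpa only [← hcoord, norm_smul, Complex.norm_I, one_mul] using
      norm_sub_le (hm.covOp i u) (hm.mulOp u)
  exact (pow_le_pow_left₀ (norm_nonneg _) hnorm 2).trans add_sq_le

end IsMultiplier

theorem norm_sq_coord_zero_testToSobolev (φ : Test ℂ) :
    ‖coord 0 (testToSobolev φ)‖ ^ 2 = ∫ p, ‖φ p‖ ^ 2 := by
  rw [coord_zero_testToSobolev]
  exact norm_sq_eq_integral (coeFn_testToLp volume φ)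

/-- The kinetic energy `∫ |i∇u + Au|²`. -/
def kinetic {A : ℝ × ℝ → ℝ × ℝ} (hA : IsAdmissible A) (u : sobolev) : ℝ :=
  ‖hA.1.covOp 1 u‖ ^ 2 + ‖hA.2.covOp 2 u‖ ^ 2

variable {A : ℝ × ℝ → ℝ × ℝ} (hA : IsAdmissible A)

theorem continuous_kinetic : Continuous (kinetic hA) := by
  unfold kinetic
  fun_prop

theorem kinetic_testToSobolev (φ : Test ℂ) :
    kinetic hA (testToSobolev φ) = ∫ p, magSq A φ p := by
  rw [kinetic, hA.1.norm_sq_covOp_one_testToSobolev, hA.2.norm_sq_covOp_two_testToSobolev]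
  exact (integral_add ((hA.1.memLp_covDeriv ex φ).integrable_norm_pow two_ne_zero)
    ((hA.2.memLp_covDeriv ey φ).integrable_norm_pow two_ne_zero)).symm

theorem IsMultiplier.exists_norm_sq_mulOp_le {m : ℝ × ℝ → ℝ} (hm : IsMultiplier m) :
    ∃ C : ℝ, 0 ≤ C ∧ ∀ u, ‖hm.mulOp u‖ ^ 2 ≤ C * (‖coord 0 u‖ ^ 2 + kinetic hA u) := by
  obtain ⟨C, hC, hbound⟩ := hm.exists_magnetic_bound hA
  refine ⟨C, hC, fun u => denseRange_testToSobolev.induction_on u ?_ fun φ => ?_⟩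
  · have := continuous_kinetic hA
    exact isClosed_le (by fun_prop) (by fun_prop)
  · rw [norm_sq_coord_zero_testToSobolev, kinetic_testToSobolev,
      norm_sq_eq_integral (hm.coeFn_mulOp_testToSobolev φ),
      ← integral_add (integrable_norm_sq φ) (hA.integrable_magSq φ)]
    exact hbound φ

theorem exists_norm_sq_le :
    ∃ C : ℝ, 0 < C ∧ ∀ u : sobolev, ‖u‖ ^ 2 ≤ C * (‖coord 0 u‖ ^ 2 + kinetic hA u) := by
  obtain ⟨C₁, hC₁, hb₁⟩ := hA.1.exists_norm_sq_mulOp_le hA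
  obtain ⟨C₂, hC₂, hb₂⟩ := hA.2.exists_norm_sq_mulOp_le hA
  refine ⟨2 * C₁ + 2 * C₂ + 2, by positivity, fun u => ?_⟩
  rw [sobolev_norm_sq]
  have hkin : kinetic hA u = ‖hA.1.covOp 1 u‖ ^ 2 + ‖hA.2.covOp 2 u‖ ^ 2 := rfl
  linarith [hb₁ u, hb₂ u, hA.1.norm_sq_coord_le 1 u, hA.2.norm_sq_coord_le 2 u,
    sq_nonneg ‖coord 0 u‖]

end CovariantDerivative

section FormOperator

variable {A : ℝ × ℝ → ℝ × ℝ} (hA : IsAdmissible A) (γ : ℝ → ℝ)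
  [IsFiniteMeasureOnCompacts (arcLength γ)]

/-- The operator on `H¹(ℝ²)` which represents the form `q - lam ‖·‖²`. -/
def formOp (α lam : ℝ) : sobolev →L[ℂ] sobolev :=
  (hA.1.covOp 1).adjoint ∘L hA.1.covOp 1 + (hA.2.covOp 2).adjoint ∘L hA.2.covOp 2
    - (traceOp γ).adjoint ∘L ((α : ℂ) • traceOp γ) - (coord 0).adjoint ∘L ((lam : ℂ) • coord 0)

theorem inner_formOp (α lam : ℝ) (u w : sobolev) :
    inner ℂ u (formOp hA γ α lam w) =
      inner ℂ (hA.1.covOp 1 u) (hA.1.covOp 1 w) + inner ℂ (hA.2.covOp 2 u) (hA.2.covOp 2 w)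
        - α * inner ℂ (traceOp γ u) (traceOp γ w) - lam * inner ℂ (coord 0 u) (coord 0 w) := by
  simp only [formOp, sub_apply, add_apply, smul_apply, ContinuousLinearMap.comp_apply,
    inner_sub_right, inner_add_right, inner_smul_right, ContinuousLinearMap.adjoint_inner_right]

theorem re_inner_formOp_self (α lam : ℝ) (u : sobolev) :
    (inner ℂ u (formOp hA γ α lam u)).re =
      kinetic hA u - α * ‖traceOp γ u‖ ^ 2 - lam * ‖coord 0 u‖ ^ 2 := by
  simp only [inner_formOp, inner_self_eq_norm_sq_to_K, Complex.coe_algebraMap,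
    ← Complex.ofReal_pow, ← Complex.ofReal_mul, ← Complex.ofReal_add, ← Complex.ofReal_sub,
    Complex.ofReal_re, kinetic]

theorem magX_coord (u : sobolev) : magX A (coord 0 u) =ᵐ[volume] hA.1.covOp 1 u := by
  filter_upwards [hA.1.coeFn_covOp 1 u] with p hp
  rw [hp, magX, weakDeriv_ex_coord]

theorem magY_coord (u : sobolev) : magY A (coord 0 u) =ᵐ[volume] hA.2.covOp 2 u := by
  filter_upwards [hA.2.coeFn_covOp 2 u] with p hp
  rw [hp, magY, weakDeriv_ey_coord]

variable {γ}

theorem form_coord {W : ℝ} (hγ : HasSpeedLE γ W) (α lam : ℝ) (u w : sobolev) :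
    form A γ α (coord 0 u) (coord 0 w) =
      inner ℂ u (formOp hA γ α lam w) + lam * inner ℂ (coord 0 u) (coord 0 w) := by
  have hinner (z z' : ℂ) : star z * z' = inner ℂ z z' := by simp [mul_comm]
  rw [inner_formOp, sub_add_cancel, form, hγ.trace_coord, hγ.trace_coord, L2.inner_def,
    L2.inner_def, L2.inner_def, ← integral_add (L2.integrable_inner _ _) (L2.integrable_inner _ _)]
  simp only [← hinner]
  congr 1
  refine integral_congr_ae ?_
  filter_upwards [magX_coord hA u, magX_coord hA w, magY_coord hA u, magY_coord hA w]
    with p hxu hxw hyu hyw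
  rw [hxu, hxw, hyu, hyw]

end FormOperator

section Coercivity

variable {A : ℝ × ℝ → ℝ × ℝ} (hA : IsAdmissible A) {γ : ℝ → ℝ}
  [IsFiniteMeasureOnCompacts (arcLength γ)]

theorem mul_norm_sq_traceOp_le {W : ℝ} (hγ : HasSpeedLE γ W) {α : ℝ} (hα : 0 < α) (u : sobolev) :
    α * ‖traceOp γ u‖ ^ 2 ≤ ((α * W) ^ 2 * ‖coord 0 u‖ ^ 2 + kinetic hA u) / 2 := by
  have hkin := continuous_kinetic hA
  refine denseRange_testToSobolev.induction_on u (isClosed_le (by fun_prop) (by fun_prop))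
    fun φ => ?_
  have hW : 0 < W := one_pos.trans_le hγ.one_le
  have hy : ‖hA.2.covOp 2 (testToSobolev φ)‖ ^ 2 ≤ kinetic hA (testToSobolev φ) :=
    le_add_of_nonneg_left (sq_nonneg _)
  rw [hA.2.norm_sq_covOp_two_testToSobolev] at hy
  rw [hγ.traceOp_testToSobolev, norm_sq_coord_zero_testToSobolev]
  set N := ∫ p, ‖φ p‖ ^ 2
  set E := ∫ p, ‖covDeriv (fun p => (A p).2) ey φ p‖ ^ 2
  calc α * ‖testToLp (arcLength γ) φ‖ ^ 2
      ≤ α * (W * ((α * W * N + (α * W)⁻¹ * E) / 2)) := by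
        gcongr
        exact hγ.norm_sq_testToLp_le hA.2 (by positivity) φ
    _ = ((α * W) ^ 2 * N + E) / 2 := by field_simp
    _ ≤ _ := by gcongr

theorem mul_norm_sq_traceOp_le_of_test {W : ℝ} (hγ : HasSpeedLE γ W) {α κ : ℝ}
    (h : ∀ φ : Test ℂ, α * ‖testToLp (arcLength γ) φ‖ ^ 2 ≤
      (∫ p, magSq A φ p) + κ * ∫ p, ‖φ p‖ ^ 2) (u : sobolev) :
    α * ‖traceOp γ u‖ ^ 2 ≤ kinetic hA u + κ * ‖coord 0 u‖ ^ 2 := by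
  have hkin := continuous_kinetic hA
  refine denseRange_testToSobolev.induction_on u (isClosed_le (by fun_prop) (by fun_prop))
    fun φ => ?_
  rw [hγ.traceOp_testToSobolev, norm_sq_coord_zero_testToSobolev, kinetic_testToSobolev]
  exact h φ

theorem exists_coercive_formOp {W : ℝ} (hγ : HasSpeedLE γ W) {α : ℝ} (hα : 0 < α) {κ lam : ℝ}
    (hκ : 0 ≤ κ) (hlam : lam < -κ)
    (h : ∀ u, α * ‖traceOp γ u‖ ^ 2 ≤ kinetic hA u + κ * ‖coord 0 u‖ ^ 2) :
    ∃ c : ℝ, 0 < c ∧ ∀ u, c * ‖u‖ ^ 2 ≤ (inner ℂ u (formOp hA γ α lam u)).re := by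
  obtain ⟨C, hC, hnorm⟩ := exists_norm_sq_le hA
  set d := -κ - lam with hd
  have hdpos : 0 < d := by linarith
  set L := (α * W) ^ 2
  have hL : 0 ≤ L := sq_nonneg _
  have hk : 0 < C * (d⁻¹ + (2 + L * d⁻¹)) := by positivity
  refine ⟨(C * (d⁻¹ + (2 + L * d⁻¹)))⁻¹, inv_pos.2 hk, fun u => (inv_mul_le_iff₀ hk).2 ?_⟩
  rw [re_inner_formOp_self]
  have hlower := h u
  have hupper := mul_norm_sq_traceOp_le hA hγ hα u
  have hN : 0 ≤ ‖coord 0 u‖ ^ 2 := sq_nonneg _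
  refine (hnorm u).trans ?_
  set N := ‖coord 0 u‖ ^ 2
  set E := kinetic hA u
  set q := E - α * ‖traceOp γ u‖ ^ 2 - lam * N with hq
  have hNq : N ≤ d⁻¹ * q := by
    rw [le_inv_mul_iff₀ hdpos, hd, hq]
    linarith
  have hEq : E ≤ 2 * q + L * N := by
    rw [hq]
    linarith [mul_nonneg (show 0 ≤ -lam by linarith) hN]
  calc C * (N + E) ≤ C * (d⁻¹ * q + (2 * q + L * (d⁻¹ * q))) := by
        gcongr
        exact hEq.trans (add_le_add_right (mul_le_mul_of_nonneg_left hNq hL) _)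
    _ = C * (d⁻¹ + (2 + L * d⁻¹)) * q := by ring

end Coercivity

section Resolvent

variable {A : ℝ × ℝ → ℝ × ℝ} {γ : ℝ → ℝ}
  [IsFiniteMeasureOnCompacts (arcLength γ)]

theorem coord_mem_hamiltonian_iff (hA : IsAdmissible A) {W : ℝ} (hγ : HasSpeedLE γ W)
    (α lam : ℝ) (w : sobolev) (g : L2) :
    (coord 0 w, g + (lam : ℂ) • coord 0 w) ∈ hamiltonian A γ α ↔
      formOp hA γ α lam w = (coord 0).adjoint g := by
  have hform (u : sobolev) : form A γ α (coord 0 u) (coord 0 w) =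
      inner ℂ (coord 0 u) (g + (lam : ℂ) • coord 0 w) ↔
        inner ℂ u (formOp hA γ α lam w) = inner ℂ u ((coord 0).adjoint g) := by
    rw [form_coord hA hγ α lam, inner_add_right, inner_smul_right, add_left_inj,
      ContinuousLinearMap.adjoint_inner_right]
  constructor
  · exact fun h => ext_inner_left ℂ fun u => (hform u).1 (h.2 _ (coord_zero_mem_H1 u))
  · refine fun h => ⟨coord_zero_mem_H1 w, fun φ hφ => ?_⟩
    obtain ⟨u, rfl⟩ := exists_coord_zero_eq hφ
    exact (hform u).2 (by rw [h])

theorem mem_resolventSet_of_isUnit (hA : IsAdmissible A) {W : ℝ} (hγ : HasSpeedLE γ W)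
    {α lam : ℝ} (hu : IsUnit (formOp hA γ α lam)) :
    (lam : ℂ) ∈ resolventSet (hamiltonian A γ α) := by
  obtain ⟨S, hS⟩ := hu
  refine ⟨coord 0 ∘L (↑S⁻¹ : sobolev →L[ℂ] sobolev) ∘L (coord 0).adjoint, fun ψ g => ?_⟩
  constructor
  · intro h
    obtain ⟨w, rfl⟩ := exists_coord_zero_eq h.1
    rw [coord_mem_hamiltonian_iff hA hγ, ← hS] at h
    rw [ContinuousLinearMap.comp_apply, ContinuousLinearMap.comp_apply, ← h,
      ← mul_apply_eq_comp, S.inv_mul, one_apply_eq_self]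
  · rintro rfl
    have hinv (w : sobolev) : formOp hA γ α lam ((↑S⁻¹ : sobolev →L[ℂ] sobolev) w) = w := by
      rw [← hS, ← mul_apply_eq_comp, S.mul_inv, one_apply_eq_self]
    exact (coord_mem_hamiltonian_iff hA hγ α lam _ g).2 (hinv _)

theorem mem_resolventSet_of_mul_norm_sq_testToLp_le (hA : IsAdmissible A) {W : ℝ}
    (hγ : HasSpeedLE γ W) {α : ℝ} (hα : 0 < α) {κ lam : ℝ} (hκ : 0 ≤ κ) (hlam : lam < -κ)
    (h : ∀ φ : Test ℂ, α * ‖testToLp (arcLength γ) φ‖ ^ 2 ≤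
      (∫ p, magSq A φ p) + κ * ∫ p, ‖φ p‖ ^ 2) :
    (lam : ℂ) ∈ resolventSet (hamiltonian A γ α) := by
  obtain ⟨c, hc, hcoercive⟩ := exists_coercive_formOp hA hγ hα hκ hlam
    (mul_norm_sq_traceOp_le_of_test hA hγ h)
  refine mem_resolventSet_of_isUnit hA hγ
    (ContinuousLinearMap.isUnit_of_forall_le_norm_inner_map _ (c := ⟨c, hc.le⟩) hc fun u => ?_)
  rw [← norm_inner_symm, mul_comm]
  exact (hcoercive u).trans (Complex.re_le_norm _)

end Resolvent

section Threshold

theorem HasSpeedLE.of_eLpNorm_deriv_sq_le {γ : ℝ → ℝ} (hγ : Continuous γ) {r : ℝ} (hr : 0 ≤ r)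
    (h : eLpNorm (deriv γ) ⊤ volume ^ 2 ≤ ENNReal.ofReal r) : HasSpeedLE γ √(1 + r) := by
  refine ⟨hγ, ?_⟩
  filter_upwards [enorm_ae_le_eLpNormEssSup (deriv γ) volume] with x hx
  rw [← eLpNorm_exponent_top] at hx
  have hsq : ENNReal.ofReal (deriv γ x ^ 2) ≤ ENNReal.ofReal r := by
    rw [← sq_abs, ENNReal.ofReal_pow (abs_nonneg _), ← Real.enorm_eq_ofReal_abs]
    exact (pow_le_pow_left₀ zero_le hx 2).trans h
  exact Real.sqrt_le_sqrt (add_le_add_right ((ENNReal.ofReal_le_ofReal_iff hr).1 hsq) 1)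

theorem hasSpeedLE_of_threshold {γ : ℝ → ℝ} (hγ : Continuous γ) {α α₀ : ℝ} (hα : 0 < α)
    (hle : α ≤ α₀) (h : eLpNorm (deriv γ) ⊤ volume ^ 2 ≤
      ENNReal.ofReal (2 * α₀ ^ 2 / α ^ 2 - 1)) : HasSpeedLE γ (√2 * (α₀ / α)) := by
  have hone : 1 ≤ (α₀ / α) ^ 2 := one_le_pow₀ ((one_le_div hα).2 hle)
  have hr : 2 * α₀ ^ 2 / α ^ 2 = 2 * (α₀ / α) ^ 2 := by rw [div_pow, mul_div_assoc]
  have hnonneg : 0 ≤ α₀ / α := div_nonneg (hα.le.trans hle) hα.le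
  have hspeed : √(1 + (2 * (α₀ / α) ^ 2 - 1)) = √2 * (α₀ / α) := by
    rw [add_sub_cancel, Real.sqrt_mul zero_le_two, Real.sqrt_sq hnonneg]
  rw [← hspeed]
  exact .of_eLpNorm_deriv_sq_le hγ (by linarith) (hr ▸ h)

theorem not_ae_eq_zero_restrict_of_support_subset {X E : Type*} [MeasurableSpace X] [Zero E]
    {μ : Measure X} {s : Set X} {f : X → E} (hs : Function.support f ⊆ s) (hm : MeasurableSet s)
    (h : ¬ f =ᵐ[μ] 0) : ¬ f =ᵐ[μ.restrict s] 0 := by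
  refine fun h0 => h ?_
  filter_upwards [(ae_restrict_iff' hm).1 h0] with x hx
  by_contra hne
  exact hne (hx (hs hne))

end Threshold

end LeakyWire

end

theorem theorem2_general (a : ℝ) (ha : 0 < a) (B : ℝ × ℝ → ℝ)
    (hB : LocallyIntegrable B volume) (hB0 : ¬ B =ᵐ[volume.restrict (LeakyWire.square a)] 0) :
    ∃ α₀ : ℝ, 0 < α₀ ∧
      ∀ A : ℝ × ℝ → ℝ × ℝ, LeakyWire.IsVectorPotential B A →
      ∀ γ : ℝ → ℝ, Continuous γ → (∀ x, a ≤ |x| → γ x = x) → (∀ x, |x| < a → |γ x| ≤ a) →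
      ∀ α : ℝ, 0 < α → α ≤ α₀ →
        eLpNorm (deriv γ) ∞ volume ^ 2 ≤ ENNReal.ofReal (2 * α₀ ^ 2 / α ^ 2 - 1) →
        ∀ lam : ℝ, lam < -(α ^ 2 / 4) →
          (lam : ℂ) ∉ LeakyWire.spectrum (LeakyWire.hamiltonian A γ α) := by
  obtain ⟨K, hK, hardy⟩ := LeakyWire.exists_hardy ha hB hB0
  set D := ((2 * a)⁻¹ + 1) * K + 1
  have hD : 0 < D := by positivity
  refine ⟨1 / (√2 * D), by positivity, fun A hA γ hγ hout hin α hα hle hderiv lam hlam => ?_⟩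
  have hspeed := LeakyWire.hasSpeedLE_of_threshold hγ hα hle hderiv
  have := hspeed.isFiniteMeasureOnCompacts_arcLength
  have hsmall : α * (√2 * (1 / (√2 * D) / α)) * D ≤ 1 := le_of_eq (by field_simp)
  exact not_not_intro <| LeakyWire.mem_resolventSet_of_mul_norm_sq_testToLp_le hA.isAdmissible
    hspeed hα (by positivity) hlam fun φ =>
      hA.isAdmissible.mul_norm_sq_testToLp_le hspeed ha hout hin hα.le hsmall (hardy A hA φ)

theorem theorem2 (a : ℝ) (ha : 0 < a) (B : ℝ × ℝ → ℝ)
    (hB : LocallyIntegrable B volume) (hBsupp : tsupport B ⊆ LeakyWire.square a)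
    (hB0 : ¬ B =ᵐ[volume] 0) :
    ∃ α₀ : ℝ, 0 < α₀ ∧
      ∀ A : ℝ × ℝ → ℝ × ℝ, LeakyWire.IsVectorPotential B A →
      ∀ γ : ℝ → ℝ, LeakyWire.IsDeformedLine a γ →
      ∀ α : ℝ, 0 < α → α ≤ α₀ →
        eLpNorm (deriv γ) ∞ volume ^ 2 ≤ ENNReal.ofReal (2 * α₀ ^ 2 / α ^ 2 - 1) →
        ∀ lam : ℝ, lam < -(α ^ 2 / 4) →
          (lam : ℂ) ∉ LeakyWire.spectrum (LeakyWire.hamiltonian A γ α) := by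
  obtain ⟨α₀, hα₀, h⟩ := theorem2_general a ha B hB
    (LeakyWire.not_ae_eq_zero_restrict_of_support_subset ((subset_tsupport B).trans hBsupp)
      (LeakyWire.measurableSet_square a) hB0)
  exact ⟨α₀, hα₀, fun A hA γ hγ => h A hA γ hγ.piecewiseC1.1 hγ.eq_outside hγ.abs_le_inside⟩
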